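/- Let $i\colon G\to H$ be a crossed module of (finite-dimensional, real) Lie groups: $i$ is a Lie group morphism and $H$ acts smoothly on $G$ from the right by automorphisms $g\mapsto g^h$ with $i(g^h)=h^{-1}i(g)h$ and $x^{i(y)}=y^{-1}xy$. Let $N_\bullet$ be the geometric nerve of the associated Lie $2$-group $G\rtimes H\rightrightarrows H\rightrightarrows\{*\}$, where $(g,h)$ is a $2$-arrow from $h$ to $h\,i(g)$, the vertical composition is $(g,h)\star(g',h\,i(g))=(gg',h)$ and the horizontal composition is $(g,h)*(g',h')=(g^{h'}g',hh')$. Thus a $q$-simplex with vertices $0,\dots,q$ consists of elements $f_{ab}\in H$ ($a<b$) and $g_{abc}\in G$ ($a<b<c$) with $f_{ab}f_{bc}\,i(g_{abc})=f_{ac}$ and $g_{abc}^{f_{cd}}\,g_{acd}=g_{bcd}\,g_{abd}$; the $f_{0b}$ and $g_{0bc}$ are smooth coordinates $N_q\cong H^q\times G^{q(q-1)/2}$, and the face map $d_i$ forgets the vertex $i$. In particular $N_2\cong G\times H\times H$ via $(g_{012},\,f_{01}f_{12},\,f_{12})$. Let $\Omega^n_{\rm tot}=\bigoplus_{p+q=n}\Omega^p(N_q)$,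 with differential $d_{\rm dR}+\partial$, where $\partial=(-1)^p\sum_{i=0}^{q+1}(-1)^i d_i^*$ on $\Omega^p(N_q)$; this is a cochain complex. Let $\mathfrak g$ be the Lie algebra of $G$, and let $(\mathfrak g^*)^{\mathfrak g,H}$ be the space of linear forms on $\mathfrak g$ invariant under the coadjoint action of $\mathfrak g$ and under the action induced by that of $H$ on $G$. For $\xi\in(\mathfrak g^*)^{\mathfrak g,H}$ let $\xi^L$ be the left-invariant $1$-form on $G$ with value $\xi$ at the identity, and let $I(\xi)$ be the pullback of $\xi^L$ along the projection $N_2\cong G\times H\times H\to G$. Then $\xi\mapsto I(\xi)$ is a linear map from $(\mathfrak g^*)^{\mathfrak g,H}$ to $\Omega^1(N_2)\subset\Omega^3_{\rm tot}$, and $d_{\rm dR}I(\xi)=0$. Suppose moreover that * every group homomorphism $G\to\mathbb R$ that is trivial on the identity component of $G$ is trivial (for example, $G$ has finitely many connected components), or * $i$ is a submersion, i.e. $d i\colon\mathfrak g\to\mathfrak h$ is surjective (for example, $H$ is discrete). Then $(d_{\rm dR}+\partial)I(\xi)=0$ for every $\xi\in(\mathfrak g^*)^{\mathfrak g,H}$;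 equivalently, $I$ is a map of cochain complexes from $(\mathfrak g^*)^{\mathfrak g,H}[3]$ (concentrated in degree $3$, with zero differential) to $(\Omega^\bullet_{\rm tot},d_{\rm dR}+\partial)$. -/

import Mathlib

open scoped Manifold ContDiff Topology

universe u

set_option linter.unusedSectionVars false

noncomputable section

namespace LieTwo

section Forms

variable {E : Type*} [NormedAddCommGroup E] [NormedSpace ℝ E] {H : Type*} [TopologicalSpace H]
  {I : ModelWithCorners ℝ E H} {M : Type*} [TopologicalSpace M] [ChartedSpace H M]
  {E' : Type*} [NormedAddCommGroup E'] [NormedSpace ℝ E'] {H' : Type*} [TopologicalSpace H']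
  {I' : ModelWithCorners ℝ E' H'} {M' : Type*} [TopologicalSpace M'] [ChartedSpace H' M']
  {p : ℕ}

/-- Left inverse of the inclusion of alternating maps into multilinear maps. -/
def altProj (E : Type*) [NormedAddCommGroup E] [NormedSpace ℝ E] (p : ℕ) :
    ContinuousMultilinearMap ℝ (fun _ : Fin p => E) ℝ →L[ℝ] E [⋀^Fin p]→L[ℝ] ℝ :=
  LinearMap.mkContinuous
    { toFun := fun f => ((p.factorial : ℝ)⁻¹) • f.alternatization
      map_add' := fun f g => by simp
      map_smul' := fun c f => by
        ext v
        simp [ContinuousMultilinearMap.alternatization_apply_apply, Finset.mul_sum,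
          mul_left_comm, Units.smul_def] } 1 (by
    intro f
    rw [one_mul]
    refine ContinuousAlternatingMap.opNorm_le_bound _ (norm_nonneg f) fun v => ?_
    have hp : (0 : ℝ) < p.factorial := by exact_mod_cast p.factorial_pos
    have h : ‖f.alternatization v‖ ≤ p.factorial * (‖f‖ * ∏ i, ‖v i‖) := by
      rw [ContinuousMultilinearMap.alternatization_apply_apply]
      refine (norm_sum_le _ _).trans ?_
      refine (Finset.sum_le_card_nsmul _ _ (‖f‖ * ∏ i, ‖v i‖) fun σ _ => ?_).trans ?_
      · have h1 : ‖Equiv.Perm.sign σ • f (v ∘ σ)‖ = ‖f (v ∘ σ)‖ := by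
          rcases Int.units_eq_one_or (Equiv.Perm.sign σ) with h | h <;> simp [h]
        rw [h1]
        refine (f.le_opNorm _).trans_eq ?_
        congr 1
        exact Equiv.prod_comp σ (fun i => ‖v i‖)
      · simp [Fintype.card_perm]
    change ‖(p.factorial : ℝ)⁻¹ • f.alternatization v‖ ≤ _
    rw [norm_smul, norm_inv, Real.norm_of_nonneg hp.le, inv_mul_le_iff₀ hp]
    exact h)

theorem altProj_apply (f : E [⋀^Fin p]→L[ℝ] ℝ) :
    altProj E p f.toContinuousMultilinearMap = f := by
  ext v
  have hp : (p.factorial : ℝ) ≠ 0 := by exact_mod_cast p.factorial_ne_zero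
  have h : ∀ σ : Equiv.Perm (Fin p), Equiv.Perm.sign σ • f (v ∘ σ) = f v := by
    intro σ
    have := f.toAlternatingMap.map_perm v σ
    have h2 : f (v ∘ σ) = Equiv.Perm.sign σ • f v := this
    rw [h2, smul_smul]
    simp
  change (p.factorial : ℝ)⁻¹ • (f.toContinuousMultilinearMap.alternatization v) = _
  rw [ContinuousMultilinearMap.alternatization_apply_apply]
  change (p.factorial : ℝ)⁻¹ • (∑ σ : Equiv.Perm (Fin p), Equiv.Perm.sign σ • f (v ∘ σ)) = _
  rw [Finset.sum_congr rfl fun σ _ => h σ]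
  simp [Fintype.card_perm, hp]

theorem minSmoothness_le_infty : minSmoothness ℝ 2 ≤ (∞ : ℕ∞ω) := by
  simp only [minSmoothness_of_isRCLikeNormedField]
  exact WithTop.coe_le_coe.2 (le_top : (2 : ℕ∞) ≤ ⊤)

theorem contDiffAt_pullback {α : E' → E' [⋀^Fin p]→L[ℝ] ℝ} {ψ : E → E'} {y : E}
    (hα : ContDiffAt ℝ ∞ α (ψ y)) (hψ : ContDiffAt ℝ ∞ ψ y) :
    ContDiffAt ℝ ∞ (fun z => (α (ψ z)).compContinuousLinearMap (fderiv ℝ ψ z)) y := by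
  have h1 : ContDiffAt ℝ ∞ (fun z => α (ψ z)) y := hα.comp y hψ
  have h2 : ContDiffAt ℝ ∞ (fun z => fderiv ℝ ψ z) y := hψ.fderiv_right (by simp)
  have h3 : ContDiffAt ℝ ∞ (fun z =>
      (α (ψ z)).toContinuousMultilinearMap) y :=
    (ContinuousAlternatingMap.toContinuousMultilinearMapLI (𝕜 := ℝ) (E := E') (F := ℝ)
      (ι := Fin p)).contDiff.contDiffAt.comp y h1
  have h4 : ContDiffAt ℝ ∞ (fun z =>
      ContinuousMultilinearMap.compContinuousLinearMapContinuousMultilinear ℝ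
        (fun _ : Fin p => E) (fun _ => E') ℝ (fun _ => fderiv ℝ ψ z)) y :=
    ContDiffAt.comp (f := fun z (_ : Fin p) => fderiv ℝ ψ z) y
      (ContinuousMultilinearMap.contDiff (𝕜 := ℝ) (E := fun _ : Fin p => E →L[ℝ] E')
        (F := ContinuousMultilinearMap ℝ (fun _ : Fin p => E') ℝ →L[ℝ]
          ContinuousMultilinearMap ℝ (fun _ : Fin p => E) ℝ)
        (ContinuousMultilinearMap.compContinuousLinearMapContinuousMultilinear ℝ
          (fun _ : Fin p => E) (fun _ => E') ℝ)).contDiffAt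
      (contDiffAt_pi.2 fun _ => h2)
  have h5 := (altProj E p).contDiff.contDiffAt.comp y (h4.clm_apply h3)
  refine h5.congr_of_eventuallyEq (Filter.Eventually.of_forall fun z => ?_)
  exact (altProj_apply ((α (ψ z)).compContinuousLinearMap (fderiv ℝ ψ z))).symm

variable (I) in
/-- A field of alternating `p`-forms on the tangent spaces of `M`, without any regularity. -/
abbrev RawForm (M : Type*) [TopologicalSpace M] [ChartedSpace H M] (p : ℕ) :=
  ∀ x : M, TangentSpace I x [⋀^Fin p]→L[ℝ] ℝ

/-- The pullback `φ^* α` of a field of alternating forms. -/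
def rawPullback (φ : M → M') (α : RawForm I' M' p) : RawForm I M p := fun y =>
  (α (φ y)).compContinuousLinearMap (mfderiv I I' φ y)

/-- The pullback of a field of alternating forms to a normed space. -/
def vecPullback (φ : E → M') (α : RawForm I' M' p) : E → E [⋀^Fin p]→L[ℝ] ℝ :=
  rawPullback (I := 𝓘(ℝ, E)) φ α

/-- The expression of `α` in the preferred chart at `x₀`. -/
def localRep (α : RawForm I M p) (x₀ : M) : E → E [⋀^Fin p]→L[ℝ] ℝ :=
  vecPullback (extChartAt I x₀).symm α

theorem rawPullback_comp {E₂ : Type*} [NormedAddCommGroup E₂] [NormedSpace ℝ E₂] {H₂ : Type*}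
    [TopologicalSpace H₂] {I₂ : ModelWithCorners ℝ E₂ H₂} {M₂ : Type*} [TopologicalSpace M₂]
    [ChartedSpace H₂ M₂] {φ : M → M'} {ψ : M' → M₂} (α : RawForm I₂ M₂ p) {y : M}
    (hψ : MDifferentiableAt I' I₂ ψ (φ y)) (hφ : MDifferentiableAt I I' φ y) :
    rawPullback (I := I) (ψ ∘ φ) α y =
      rawPullback (I := I) (I' := I') φ (rawPullback (I := I') ψ α) y := by
  unfold rawPullback
  rw [mfderiv_comp y hψ hφ]
  rfl

theorem rawPullback_congr {φ φ' : M → M'} (α : RawForm I' M' p) {y : M}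
    (h : φ =ᶠ[𝓝 y] φ') :
    rawPullback (I := I) φ α y = rawPullback (I := I) φ' α y := by
  have h0 : ∀ a b : M', a = b → ∀ w : Fin p → E', (α a : E' [⋀^Fin p]→L[ℝ] ℝ) w =
      (α b : E' [⋀^Fin p]→L[ℝ] ℝ) w := by
    rintro a b rfl w
    rfl
  unfold rawPullback
  rw [h.mfderiv_eq]
  ext v
  exact h0 _ _ h.eq_of_nhds _

/-- Smoothness of a field of forms: its expression in every preferred chart is smooth. -/
def IsSmoothForm (α : RawForm I M p) : Prop :=
  ∀ x₀ : M, ContDiffOn ℝ ∞ (localRep α x₀) (extChartAt I x₀).target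

/-- The exterior derivative, computed at `x` in the preferred chart at `x`. -/
def rawExtDeriv (α : RawForm I M p) : RawForm I M (p + 1) := fun x =>
  (extDeriv (localRep α x) (extChartAt I x x)).compContinuousLinearMap
    (mfderiv I 𝓘(ℝ, E) (extChartAt I x) x)

theorem localRep_add (α β : RawForm I M p) (x₀ : M) :
    localRep (α + β) x₀ = localRep α x₀ + localRep β x₀ := rfl

theorem localRep_smul (c : ℝ) (α : RawForm I M p) (x₀ : M) :
    localRep (c • α) x₀ = c • localRep α x₀ := rfl

variable (I M p) in
/-- The space `Ω^p(M)` of smooth differential `p`-forms. -/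
def DForm : Submodule ℝ (RawForm I M p) where
  carrier := {α | IsSmoothForm α}
  zero_mem' := fun _ => contDiffOn_const (c := (0 : E [⋀^Fin p]→L[ℝ] ℝ))
  add_mem' := fun hα hβ x₀ => (hα x₀).add (hβ x₀)
  smul_mem' := fun c _ hα x₀ => (hα x₀).const_smul c

theorem DForm.smooth (α : DForm I M p) : IsSmoothForm α.1 := α.2

section

variable [I.Boundaryless] [I'.Boundaryless] [IsManifold I ∞ M] [IsManifold I' ∞ M']

theorem contMDiffAt_symm {x₀ : M} {y : E} (hy : y ∈ (extChartAt I x₀).target) :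
    ContMDiffAt 𝓘(ℝ, E) I ∞ (extChartAt I x₀).symm y :=
  (contMDiffOn_extChartAt_symm (n := ∞) x₀).contMDiffAt
    ((isOpen_extChartAt_target x₀).mem_nhds hy)

/-- A map from a vector space to a manifold, written locally through a chart of the target. -/
theorem rawPullback_local {α : RawForm I' M' p} {φ : E → M'} {y : E}
    (hφ : ContMDiffAt 𝓘(ℝ, E) I' ∞ φ y) :
    ContDiffAt ℝ ∞ (extChartAt I' (φ y) ∘ φ) y ∧
    vecPullback φ α =ᶠ[𝓝 y] fun z =>
      (localRep α (φ y) ((extChartAt I' (φ y) ∘ φ) z)).compContinuousLinearMap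
        (fderiv ℝ (extChartAt I' (φ y) ∘ φ) z) := by
  have hc : ContMDiffAt I' 𝓘(ℝ, E') ∞ (extChartAt I' (φ y)) (φ y) := contMDiffAt_extChartAt
  have hs : ContMDiffAt 𝓘(ℝ, E) 𝓘(ℝ, E') ∞ (extChartAt I' (φ y) ∘ φ) y := hc.comp y hφ
  refine ⟨contMDiffAt_iff_contDiffAt.1 hs, ?_⟩
  have h1 : ∀ᶠ z in 𝓝 y, φ z ∈ (extChartAt I' (φ y)).source :=
    hφ.continuousAt.eventually (extChartAt_source_mem_nhds (φ y))
  have h2 : ∀ᶠ z in 𝓝 y, ContMDiffAt 𝓘(ℝ, E) 𝓘(ℝ, E') 1 (extChartAt I' (φ y) ∘ φ) z :=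
    (contMDiffAt_iff_contMDiffAt_nhds (by simp)).1
      (hs.of_le (by exact_mod_cast (le_top : (1 : ℕ∞) ≤ ⊤)))
  filter_upwards [h1.eventually_nhds, h2] with z hz hz2
  have hz1 := hz.self_of_nhds
  have e : φ =ᶠ[𝓝 z] (extChartAt I' (φ y)).symm ∘ (extChartAt I' (φ y) ∘ φ) := by
    filter_upwards [hz] with w hw
    exact ((extChartAt I' (φ y)).left_inv hw).symm
  have hsymm : MDifferentiableAt 𝓘(ℝ, E') I' (extChartAt I' (φ y)).symm
      ((extChartAt I' (φ y) ∘ φ) z) :=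
    (contMDiffAt_symm ((extChartAt I' (φ y)).map_source hz1)).mdifferentiableAt (by simp)
  unfold vecPullback
  rw [rawPullback_congr α e, rawPullback_comp α hsymm (hz2.mdifferentiableAt (by simp))]
  simp only [localRep, vecPullback, rawPullback, mfderiv_eq_fderiv]
  rfl

theorem IsSmoothForm.contDiffAt_vecPullback {α : RawForm I' M' p} (hα : IsSmoothForm α)
    {φ : E → M'} {y : E} (hφ : ContMDiffAt 𝓘(ℝ, E) I' ∞ φ y) :
    ContDiffAt ℝ ∞ (vecPullback φ α) y := by
  obtain ⟨h1, h2⟩ := rawPullback_local (α := α) hφ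
  refine (contDiffAt_pullback ?_ h1).congr_of_eventuallyEq h2
  exact (hα (φ y)).contDiffAt ((isOpen_extChartAt_target (φ y)).mem_nhds (mem_extChartAt_target _))

/-- The exterior derivative commutes with pullback to a vector space; in particular it can be
computed in any chart. -/
theorem IsSmoothForm.extDeriv_vecPullback {α : RawForm I' M' p} (hα : IsSmoothForm α)
    {φ : E → M'} {y : E} (hφ : ContMDiffAt 𝓘(ℝ, E) I' ∞ φ y) :
    extDeriv (vecPullback φ α) y =
      vecPullback φ (rawExtDeriv α) y := by
  obtain ⟨h1, h2⟩ := rawPullback_local (α := α) hφ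
  have h3 : ContDiffAt ℝ ∞ (localRep α (φ y)) ((extChartAt I' (φ y) ∘ φ) y) :=
    (hα (φ y)).contDiffAt ((isOpen_extChartAt_target (φ y)).mem_nhds (mem_extChartAt_target _))
  rw [Filter.EventuallyEq.extDeriv_eq h2,
    extDeriv_pullback (h3.differentiableAt (by simp)) h1 minSmoothness_le_infty]
  have hc : ContMDiffAt I' 𝓘(ℝ, E') ∞ (extChartAt I' (φ y)) (φ y) := contMDiffAt_extChartAt
  have h4 : fderiv ℝ (extChartAt I' (φ y) ∘ φ) y =
      (mfderiv I' 𝓘(ℝ, E') (extChartAt I' (φ y)) (φ y)).comp (mfderiv 𝓘(ℝ, E) I' φ y) := by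
    rw [← mfderiv_eq_fderiv]
    exact mfderiv_comp y (hc.mdifferentiableAt (by simp)) (hφ.mdifferentiableAt (by simp))
  rw [h4]
  rfl

theorem IsSmoothForm.localRep_rawExtDeriv {α : RawForm I M p} (hα : IsSmoothForm α) (x₀ : M)
    {y : E} (hy : y ∈ (extChartAt I x₀).target) :
    localRep (rawExtDeriv α) x₀ y = extDeriv (localRep α x₀) y :=
  (hα.extDeriv_vecPullback (contMDiffAt_symm hy)).symm

theorem contDiffAt_extDeriv {β : E → E [⋀^Fin p]→L[ℝ] ℝ} {y : E} (h : ContDiffAt ℝ ∞ β y) :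
    ContDiffAt ℝ ∞ (extDeriv β) y :=
  (ContinuousAlternatingMap.alternatizeUncurryFinCLM ℝ E ℝ).contDiff.contDiffAt.comp y
    (h.fderiv_right (by simp))

theorem IsSmoothForm.d {α : RawForm I M p} (hα : IsSmoothForm α) :
    IsSmoothForm (rawExtDeriv α) := by
  intro x₀ y hy
  have h : ContDiffAt ℝ ∞ (extDeriv (localRep α x₀)) y :=
    contDiffAt_extDeriv (hα.contDiffAt_vecPullback (contMDiffAt_symm hy))
  refine (h.congr_of_eventuallyEq ?_).contDiffWithinAt
  filter_upwards [(isOpen_extChartAt_target (I := I) x₀).mem_nhds hy] with z hz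
  exact hα.localRep_rawExtDeriv x₀ hz

theorem IsSmoothForm.d_d {α : RawForm I M p} (hα : IsSmoothForm α) :
    rawExtDeriv (rawExtDeriv α) = 0 := by
  funext x
  have hx : extChartAt I x x ∈ (extChartAt I x).target := mem_extChartAt_target x
  have h : localRep (rawExtDeriv α) x =ᶠ[𝓝 (extChartAt I x x)]
      extDeriv (localRep α x) := by
    filter_upwards [(isOpen_extChartAt_target (I := I) x).mem_nhds hx] with z hz
    exact hα.localRep_rawExtDeriv x hz
  have h0 : extDeriv (localRep (rawExtDeriv α) x) (extChartAt I x x) = 0 := by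
    rw [Filter.EventuallyEq.extDeriv_eq h]
    exact extDeriv_extDeriv_apply (hα.contDiffAt_vecPullback (contMDiffAt_symm hx))
      minSmoothness_le_infty
  unfold rawExtDeriv at h0 ⊢
  rw [h0]
  rfl

theorem localRep_rawPullback {f : M → M'} (hf : ContMDiff I I' ∞ f) (α : RawForm I' M' p)
    (x₀ : M) {y : E} (hy : y ∈ (extChartAt I x₀).target) :
    localRep (rawPullback (I := I) f α) x₀ y =
      vecPullback (f ∘ (extChartAt I x₀).symm) α y :=
  (rawPullback_comp α ((hf _).mdifferentiableAt (by simp))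
    ((contMDiffAt_symm hy).mdifferentiableAt (by simp))).symm

theorem IsSmoothForm.pullback {f : M → M'} (hf : ContMDiff I I' ∞ f) {α : RawForm I' M' p}
    (hα : IsSmoothForm α) : IsSmoothForm (rawPullback (I := I) f α) := by
  intro x₀ y hy
  refine ((hα.contDiffAt_vecPullback (φ := f ∘ (extChartAt I x₀).symm)
    ((hf _).comp y (contMDiffAt_symm hy))).congr_of_eventuallyEq ?_).contDiffWithinAt
  filter_upwards [(isOpen_extChartAt_target (I := I) x₀).mem_nhds hy] with z hz
  exact localRep_rawPullback hf α x₀ hz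

theorem IsSmoothForm.d_pullback {f : M → M'} (hf : ContMDiff I I' ∞ f)
    {α : RawForm I' M' p} (hα : IsSmoothForm α) :
    rawExtDeriv (rawPullback (I := I) f α) =
      rawPullback (I := I) f (rawExtDeriv α) := by
  funext x
  have hx : extChartAt I x x ∈ (extChartAt I x).target := mem_extChartAt_target x
  have h : localRep (rawPullback (I := I) f α) x =ᶠ[𝓝 (extChartAt I x x)]
      vecPullback (f ∘ (extChartAt I x).symm) α := by
    filter_upwards [(isOpen_extChartAt_target (I := I) x).mem_nhds hx] with z hz
    exact localRep_rawPullback hf α x hz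
  have hs := contMDiffAt_symm hx
  have hfs : ContMDiffAt 𝓘(ℝ, E) I' ∞ (f ∘ (extChartAt I x).symm) (extChartAt I x x) :=
    (hf _).comp _ hs
  have hc : ContMDiffAt I 𝓘(ℝ, E) ∞ (extChartAt I x) x := contMDiffAt_extChartAt
  change (extDeriv (localRep (rawPullback (I := I) f α) x)
    (extChartAt I x x)).compContinuousLinearMap (mfderiv I 𝓘(ℝ, E) (extChartAt I x) x) = _
  rw [Filter.EventuallyEq.extDeriv_eq h, hα.extDeriv_vecPullback hfs]
  have e : f =ᶠ[𝓝 x] (f ∘ (extChartAt I x).symm) ∘ extChartAt I x := by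
    filter_upwards [extChartAt_source_mem_nhds (I := I) x] with z hz
    exact congrArg f ((extChartAt I x).left_inv hz).symm
  rw [rawPullback_congr _ e, rawPullback_comp _ (hfs.mdifferentiableAt (by simp))
    (hc.mdifferentiableAt (by simp))]
  rfl

theorem IsSmoothForm.differentiableAt {α : RawForm I M p} (hα : IsSmoothForm α) (x : M) :
    DifferentiableAt ℝ (localRep α x) (extChartAt I x x) :=
  (hα.contDiffAt_vecPullback (contMDiffAt_symm (mem_extChartAt_target x))).differentiableAt
    (by simp)

/-- The de Rham differential `d : Ω^p(M) → Ω^{p+1}(M)`. -/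
def dR : DForm I M p →ₗ[ℝ] DForm I M (p + 1) where
  toFun α := ⟨rawExtDeriv α.1, (DForm.smooth α).d⟩
  map_add' := by
    intro α β
    apply Subtype.ext
    funext x
    simp only [rawExtDeriv, Submodule.coe_add, localRep_add, Pi.add_apply]
    rw [extDeriv_add ((DForm.smooth α).differentiableAt x) ((DForm.smooth β).differentiableAt x)]
    rfl
  map_smul' := by
    intro c α
    apply Subtype.ext
    funext x
    simp only [rawExtDeriv, Submodule.coe_smul, localRep_smul, Pi.smul_apply]
    rw [extDeriv_smul c]
    rfl

/-- The pullback `f^* : Ω^p(M') → Ω^p(M)` along a smooth map `f : M → M'`. -/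
def pullback (f : C^∞⟮I, M; I', M'⟯) : DForm I' M' p →ₗ[ℝ] DForm I M p where
  toFun α := ⟨rawPullback f α.1, (DForm.smooth α).pullback f.contMDiff⟩
  map_add' _ _ := rfl
  map_smul' _ _ := rfl

theorem dR_dR (α : DForm I M p) : dR (dR α) = 0 := Subtype.ext (DForm.smooth α).d_d

theorem dR_pullback (f : C^∞⟮I, M; I', M'⟯) (α : DForm I' M' p) :
    dR (pullback f α) = pullback f (dR α) := Subtype.ext ((DForm.smooth α).d_pullback f.contMDiff)

theorem pullback_comp {E₂ : Type*} [NormedAddCommGroup E₂] [NormedSpace ℝ E₂] {H₂ : Type*}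
    [TopologicalSpace H₂] {I₂ : ModelWithCorners ℝ E₂ H₂} [I₂.Boundaryless] {M₂ : Type*}
    [TopologicalSpace M₂] [ChartedSpace H₂ M₂] [IsManifold I₂ ∞ M₂]
    (g : C^∞⟮I', M'; I₂, M₂⟯) (f : C^∞⟮I, M; I', M'⟯) (α : DForm I₂ M₂ p) :
    pullback f (pullback g α) = pullback (g.comp f) α :=
  Subtype.ext (funext fun _ => (rawPullback_comp α.1 (g.contMDiff.mdifferentiableAt (by simp))
    (f.contMDiff.mdifferentiableAt (by simp))).symm)

end

end Forms

section Pi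

variable {ι : Type*} [Fintype ι] {E : ι → Type*} [∀ i, NormedAddCommGroup (E i)]
  [∀ i, NormedSpace ℝ (E i)] {H : ι → Type*} [∀ i, TopologicalSpace (H i)]
  {I : ∀ i, ModelWithCorners ℝ (E i) (H i)} {M : ι → Type*} [∀ i, TopologicalSpace (M i)]
  [∀ i, ChartedSpace (H i) (M i)]

instance boundaryless_pi [∀ i, (I i).Boundaryless] : (ModelWithCorners.pi I).Boundaryless where
  range_eq_univ := by
    refine Set.eq_univ_of_forall fun y => ?_
    refine ⟨fun i => (I i).symm (y i), funext fun i => ?_⟩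
    exact (I i).right_inv (by rw [(I i).range_eq_univ]; trivial)

instance isManifold_pi [∀ i, IsManifold (I i) ∞ (M i)] [∀ i, (I i).Boundaryless] :
    IsManifold (ModelWithCorners.pi I) ∞ (∀ i, M i) := by
  refine isManifold_of_contDiffOn _ _ _ ?_
  rintro _ _ ⟨e, he, rfl⟩ ⟨e', he', rfl⟩
  refine contDiffOn_pi.2 fun i => ?_
  have h := (contDiffGroupoid ∞ (I i)).compatible (he i trivial) (he' i trivial)
  rw [contDiffGroupoid, mem_groupoid_of_pregroupoid] at h
  have h1 : ContDiffOn ℝ ∞ ((I i) ∘ ((e i).symm.trans (e' i)) ∘ (I i).symm)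
    ((I i).symm ⁻¹' ((e i).symm.trans (e' i)).source ∩ Set.range (I i)) := h.1
  refine h1.comp (ContinuousLinearMap.proj (R := ℝ) (φ := E) i).contDiff.contDiffOn ?_
  rintro y ⟨hy, -⟩
  refine ⟨⟨hy.1 i trivial, hy.2 i trivial⟩, ?_⟩
  rw [(I i).range_eq_univ]
  trivial

theorem contMDiff_pi {E' : Type*} [NormedAddCommGroup E'] [NormedSpace ℝ E'] {H' : Type*}
    [TopologicalSpace H'] {I' : ModelWithCorners ℝ E' H'} {M' : Type*} [TopologicalSpace M']
    [ChartedSpace H' M'] {f : M' → ∀ i, M i}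
    (h : ∀ i, ContMDiff I' (I i) ∞ fun x => f x i) :
    ContMDiff I' (ModelWithCorners.pi I) ∞ f := by
  intro x
  rw [contMDiffAt_iff_target]
  refine ⟨continuousAt_pi.2 fun i => (h i x).continuousAt, ?_⟩
  refine contMDiffAt_pi_space.2 fun i => ?_
  exact ((contMDiffAt_iff_target.1 (h i x)).2)

theorem contMDiff_eval (i : ι) [∀ i, IsManifold (I i) ∞ (M i)] [∀ i, (I i).Boundaryless] :
    ContMDiff (ModelWithCorners.pi I) (I i) ∞ fun x : ∀ i, M i => x i := by
  intro x
  rw [contMDiffAt_iff]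
  refine ⟨(continuous_apply i).continuousAt, ?_⟩
  have h : ContDiff ℝ ∞ (fun y : (∀ i, E i) => y i) :=
    (ContinuousLinearMap.proj (R := ℝ) (φ := E) i).contDiff
  refine (h.contDiffAt.congr_of_eventuallyEq ?_).contDiffWithinAt
  filter_upwards [(isOpen_extChartAt_target (I := ModelWithCorners.pi I) x).mem_nhds
    (mem_extChartAt_target x)] with y hy
  exact congrFun ((extChartAt (ModelWithCorners.pi I) x).right_inv hy) i

end Pi

section Nerve

variable {V : Type*} [NormedAddCommGroup V] [NormedSpace ℝ V]
  {W : Type*} [NormedAddCommGroup W] [NormedSpace ℝ W]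
  {G : Type*} [TopologicalSpace G] [ChartedSpace V G] [Group G]
  {H : Type*} [TopologicalSpace H] [ChartedSpace W H] [Group H]

variable (V W G H) in
/-- A crossed module of Lie groups `bd : G → H`, with right action `(g, h) ↦ g^h = act g h`. -/
structure LieCrossedModule where
  bd : G →* H
  contMDiff_bd : ContMDiff 𝓘(ℝ, V) 𝓘(ℝ, W) ∞ bd
  act : G → H → G
  contMDiff_act : ContMDiff (𝓘(ℝ, V).prod 𝓘(ℝ, W)) 𝓘(ℝ, V) ∞ fun x : G × H => act x.1 x.2
  mul_act : ∀ (x y : G) (h : H), act (x * y) h = act x h * act y h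
  act_one : ∀ x : G, act x 1 = x
  act_mul : ∀ (x : G) (h k : H), act x (h * k) = act (act x h) k
  bd_act : ∀ (x : G) (h : H), bd (act x h) = h⁻¹ * bd x * h
  act_bd : ∀ x y : G, act x (bd y) = y⁻¹ * x * y

namespace LieCrossedModule

variable (X : LieCrossedModule V W G H)

theorem one_act (h : H) : X.act 1 h = 1 := by
  have := X.mul_act 1 1 h
  simpa using this

theorem inv_act (x : G) (h : H) : X.act x⁻¹ h = (X.act x h)⁻¹ := by
  rw [eq_inv_iff_mul_eq_one, ← X.mul_act, inv_mul_cancel, X.one_act]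

/-- A `q`-simplex of the geometric nerve of the 2-group `G ⋊ H ⇉ H ⇉ *`, with vertices
`0, …, q`: the edge from `a` to `b` is labelled by a 1-arrow `edge a b ∈ H`, the triangle `a b c`
by the 2-arrow `(tri a b c, edge a b * edge b c) : edge a b * edge b c ⇒ edge a c` (recall that
`(g, h)` has source `h` and target `h * bd g`), and every tetrahedron `a b c d` commutes, i.e.
`(α_{abc} * edge c d) ⋆ α_{acd} = (edge a b * α_{bcd}) ⋆ α_{abd}`; the `G`-components of the two
sides are those in `tetra`, and their sources agree automatically. -/
@[ext]
structure Simplex (q : ℕ) where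
  edge : ∀ a b : Fin (q + 1), a < b → H
  tri : ∀ a b c : Fin (q + 1), a < b → b < c → G
  target_eq : ∀ a b c hab hbc,
    edge a b hab * edge b c hbc * X.bd (tri a b c hab hbc) = edge a c (hab.trans hbc)
  tetra : ∀ a b c d hab hbc hcd,
    X.act (tri a b c hab hbc) (edge c d hcd) * tri a c d (hab.trans hbc) hcd =
      tri b c d hbc hcd * tri a b d hab (hbc.trans hcd)

/-- The `i`-th face of a simplex: restriction to the vertices different from `i`. -/
def Simplex.face {q : ℕ} (i : Fin (q + 2)) (σ : X.Simplex (q + 1)) : X.Simplex q where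
  edge a b hab := σ.edge (i.succAbove a) (i.succAbove b) (Fin.strictMono_succAbove i hab)
  tri a b c hab hbc := σ.tri (i.succAbove a) (i.succAbove b) (i.succAbove c)
    (Fin.strictMono_succAbove i hab) (Fin.strictMono_succAbove i hbc)
  target_eq _ _ _ _ _ := σ.target_eq _ _ _ _ _
  tetra _ _ _ _ _ _ _ := σ.tetra _ _ _ _ _ _ _

variable (G H) in
/-- The manifold `N_q ≅ H^q × G^{q(q-1)/2}` of `q`-simplices of the nerve, in the coordinates
given by the edges `0 → j + 1` (for `j < q`) and the triangles `0, j + 1, k + 1`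
(for `j < k < q`), which determine the simplex; see `simplexEquiv`. -/
abbrev N (q : ℕ) : Type _ := (Fin q → H) × ({e : Fin q × Fin q // e.1 < e.2} → G)

/-- The edge `0 → a`, which is `1` for `a = 0`. -/
def coordEdge {q : ℕ} (x : N G H q) : Fin (q + 1) → H := Fin.cons 1 x.1

/-- The triangle `0, a, b`, which is `1` for `a = 0` (and by convention if not `a < b`). -/
def coordTri {q : ℕ} (x : N G H q) : Fin (q + 1) → Fin (q + 1) → G :=
  Fin.cons (fun _ => 1) fun j => Fin.cons 1 fun k => if h : j < k then x.2 ⟨(j, k), h⟩ else 1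

/-- The edge `a → b` of the simplex with the given coordinates. -/
def edgeOf {q : ℕ} (x : N G H q) (a b : Fin (q + 1)) : H :=
  (coordEdge x a)⁻¹ * coordEdge x b * (X.bd (coordTri x a b))⁻¹

/-- The triangle `a, b, c` of the simplex with the given coordinates. -/
def triOf {q : ℕ} (x : N G H q) (a b c : Fin (q + 1)) : G :=
  X.act (coordTri x a b) (X.edgeOf x b c) * coordTri x b c * (coordTri x a c)⁻¹

theorem edgeOf_mul {q : ℕ} (x : N G H q) (a b c : Fin (q + 1)) :
    X.edgeOf x a b * X.edgeOf x b c * X.bd (X.triOf x a b c) = X.edgeOf x a c := by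
  simp only [triOf, map_mul, map_inv, X.bd_act, edgeOf]
  group

theorem triOf_mul {q : ℕ} (x : N G H q) (a b c d : Fin (q + 1)) :
    X.act (X.triOf x a b c) (X.edgeOf x c d) * X.triOf x a c d =
      X.triOf x b c d * X.triOf x a b d := by
  have h1 : X.triOf x a b d = X.act (X.act (coordTri x a b) (X.edgeOf x b c * X.edgeOf x c d))
      (X.bd (X.triOf x b c d)) * coordTri x b d * (coordTri x a d)⁻¹ := by
    rw [← X.act_mul, X.edgeOf_mul]
    rfl
  rw [h1, X.act_bd]
  simp only [triOf, X.mul_act, X.inv_act, X.act_mul]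
  group

/-- The nerve coordinates: `N_q` is the set of `q`-simplices. -/
def simplexEquiv (q : ℕ) : N G H q ≃ X.Simplex q where
  toFun x :=
    { edge := fun a b _ => X.edgeOf x a b
      tri := fun a b c _ _ => X.triOf x a b c
      target_eq := fun a b c _ _ => X.edgeOf_mul x a b c
      tetra := fun a b c d _ _ _ => X.triOf_mul x a b c d }
  invFun σ := (fun j => σ.edge 0 j.succ j.succ_pos,
    fun e => σ.tri 0 e.1.1.succ e.1.2.succ (Fin.succ_pos _) (Fin.succ_lt_succ_iff.2 e.2))
  left_inv x := by
    refine Prod.ext (funext fun j => ?_) (funext fun e => ?_)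
    · simp [edgeOf, coordEdge, coordTri]
    · simp [triOf, coordTri, X.one_act, e.2]
  right_inv σ := by
    set x : N G H q := (fun j => σ.edge 0 j.succ j.succ_pos,
      fun e => σ.tri 0 e.1.1.succ e.1.2.succ (Fin.succ_pos _) (Fin.succ_lt_succ_iff.2 e.2))
    have hE : ∀ a b (hab : a < b), X.edgeOf x a b = σ.edge a b hab := by
      intro a b hab
      obtain ⟨k, rfl⟩ := Fin.exists_succ_eq_of_ne_zero (Fin.ne_zero_of_lt hab)
      cases a using Fin.cases with
      | zero => simp [edgeOf, coordEdge, coordTri, x]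
      | succ j =>
        have hjk : j < k := Fin.succ_lt_succ_iff.1 hab
        have := σ.target_eq 0 j.succ k.succ j.succ_pos hab
        simp only [edgeOf, coordEdge, coordTri, x, Fin.cons_succ, hjk, dif_pos]
        rw [← this]
        group
    have hT : ∀ a b c (hab : a < b) (hbc : b < c), X.triOf x a b c = σ.tri a b c hab hbc := by
      intro a b c hab hbc
      obtain ⟨k, rfl⟩ := Fin.exists_succ_eq_of_ne_zero (Fin.ne_zero_of_lt hab)
      obtain ⟨l, rfl⟩ := Fin.exists_succ_eq_of_ne_zero (Fin.ne_zero_of_lt hbc)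
      have hkl : k < l := Fin.succ_lt_succ_iff.1 hbc
      cases a using Fin.cases with
      | zero => simp [triOf, coordTri, X.one_act, x, hkl]
      | succ j =>
        have hjk : j < k := Fin.succ_lt_succ_iff.1 hab
        have := σ.tetra 0 j.succ k.succ l.succ j.succ_pos hab hbc
        simp only [triOf, hE _ _ hbc, coordTri, x, Fin.cons_succ, hjk, hkl, hjk.trans hkl, dif_pos]
        rw [this]
        group
    ext a b hab
    · exact hE a b hab
    · exact hT _ _ _ _ _

variable [LieGroup 𝓘(ℝ, V) ∞ G] [LieGroup 𝓘(ℝ, W) ∞ H]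

variable (V W) in
/-- The model with corners of the manifold `N_q`. -/
abbrev modelN (q : ℕ) :=
  (ModelWithCorners.pi fun _ : Fin q => 𝓘(ℝ, W)).prod
    (ModelWithCorners.pi fun _ : {e : Fin q × Fin q // e.1 < e.2} => 𝓘(ℝ, V))

/-- The face map `d_i : N_{q+1} → N_q`, in coordinates. -/
def faceFun {q : ℕ} (i : Fin (q + 2)) (x : N G H (q + 1)) : N G H q :=
  (X.simplexEquiv q).symm (Simplex.face X i (X.simplexEquiv (q + 1) x))

theorem contMDiff_coordEdge {q : ℕ} (a : Fin (q + 1)) :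
    ContMDiff (modelN V W q) 𝓘(ℝ, W) ∞ fun x : N G H q => coordEdge x a := by
  cases a using Fin.cases with
  | zero => exact contMDiff_const
  | succ j =>
    exact (contMDiff_eval (I := fun _ : Fin q => 𝓘(ℝ, W)) (M := fun _ => H) j).comp contMDiff_fst

theorem contMDiff_coordTri {q : ℕ} (a b : Fin (q + 1)) :
    ContMDiff (modelN V W q) 𝓘(ℝ, V) ∞ fun x : N G H q => coordTri x a b := by
  cases a using Fin.cases with
  | zero => exact contMDiff_const
  | succ j =>
    cases b using Fin.cases with
    | zero => exact contMDiff_const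
    | succ k =>
      by_cases h : j < k
      · simp only [coordTri, Fin.cons_succ, h, dif_pos]
        exact (contMDiff_eval (I := fun _ : {e : Fin q × Fin q // e.1 < e.2} => 𝓘(ℝ, V))
          (M := fun _ => G) ⟨(j, k), h⟩).comp contMDiff_snd
      · simp only [coordTri, Fin.cons_succ, h, dif_neg, not_false_eq_true]
        exact contMDiff_const

theorem contMDiff_edgeOf {q : ℕ} (a b : Fin (q + 1)) :
    ContMDiff (modelN V W q) 𝓘(ℝ, W) ∞ fun x : N G H q => X.edgeOf x a b :=
  ((contMDiff_coordEdge a).inv.mul (contMDiff_coordEdge b)).mul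
    (X.contMDiff_bd.comp (contMDiff_coordTri a b)).inv

theorem contMDiff_triOf {q : ℕ} (a b c : Fin (q + 1)) :
    ContMDiff (modelN V W q) 𝓘(ℝ, V) ∞ fun x : N G H q => X.triOf x a b c :=
  ((X.contMDiff_act.comp ((contMDiff_coordTri a b).prodMk (X.contMDiff_edgeOf b c))).mul
    (contMDiff_coordTri b c)).mul (contMDiff_coordTri a c).inv

/-- The face map `d_i : N_{q+1} → N_q` as a smooth map. -/
def face {q : ℕ} (i : Fin (q + 2)) :
    C^∞⟮modelN V W (q + 1), N G H (q + 1); modelN V W q, N G H q⟯ where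
  val := X.faceFun i
  property := ContMDiff.prodMk
    (contMDiff_pi fun _ => X.contMDiff_edgeOf _ _) (contMDiff_pi fun _ => X.contMDiff_triOf _ _ _)

theorem Simplex.edge_congr {q : ℕ} (σ : X.Simplex q) {a b a' b' : Fin (q + 1)} (ha : a = a')
    (hb : b = b') (h : a < b) (h' : a' < b') : σ.edge a b h = σ.edge a' b' h' := by
  subst ha hb
  rfl

theorem Simplex.tri_congr {q : ℕ} (σ : X.Simplex q) {a b c a' b' c' : Fin (q + 1)} (ha : a = a')
    (hb : b = b') (hc : c = c') (h : a < b) (h₂ : b < c) (h' : a' < b') (h₂' : b' < c') :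
    σ.tri a b c h h₂ = σ.tri a' b' c' h' h₂' := by
  subst ha hb hc
  rfl

theorem succAbove_comm {q : ℕ} {i j : Fin (q + 2)} (hij : i ≤ j) (a : Fin (q + 1)) :
    j.succ.succAbove (i.succAbove a) = i.castSucc.succAbove (j.succAbove a) := by
  have := congrArg (fun f => f.toOrderHom a) (SimplexCategory.δ_comp_δ hij)
  exact this

/-- The simplicial identity for iterated faces. -/
theorem face_face {q : ℕ} {i j : Fin (q + 2)} (hij : i ≤ j) :
    (X.face i).comp (X.face j.succ) = (X.face j).comp (X.face (q := q + 1) i.castSucc) := by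
  refine Subtype.ext (funext fun x => ?_)
  change X.faceFun i (X.faceFun j.succ x) = X.faceFun j (X.faceFun i.castSucc x)
  simp only [faceFun, Equiv.apply_symm_apply]
  congr 1
  refine Simplex.ext (funext fun a => funext fun b => funext fun hab => ?_)
    (funext fun a => funext fun b => funext fun c => funext fun hab => funext fun hbc => ?_)
  · exact Simplex.edge_congr X (X.simplexEquiv (q + 2) x) (succAbove_comm hij a)
      (succAbove_comm hij b)
      (Fin.strictMono_succAbove _ (Fin.strictMono_succAbove _ hab))
      (Fin.strictMono_succAbove _ (Fin.strictMono_succAbove _ hab))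
  · exact Simplex.tri_congr X (X.simplexEquiv (q + 2) x) (succAbove_comm hij a)
      (succAbove_comm hij b) (succAbove_comm hij c)
      (Fin.strictMono_succAbove _ (Fin.strictMono_succAbove _ hab))
      (Fin.strictMono_succAbove _ (Fin.strictMono_succAbove _ hbc))
      (Fin.strictMono_succAbove _ (Fin.strictMono_succAbove _ hab))
      (Fin.strictMono_succAbove _ (Fin.strictMono_succAbove _ hbc))

variable (V W G H) in
/-- The space `Ω^p(N_q)` of smooth `p`-forms on the manifold of `q`-simplices. -/
def Form (p q : ℕ) : Type _ := DForm (modelN V W q) (N G H q) p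

instance (p q : ℕ) : AddCommGroup (Form V W G H p q) :=
  inferInstanceAs (AddCommGroup (DForm (modelN V W q) (N G H q) p))

instance (p q : ℕ) : Module ℝ (Form V W G H p q) :=
  inferInstanceAs (Module ℝ (DForm (modelN V W q) (N G H q) p))

/-- The underlying field of alternating forms. -/
def Form.raw {p q : ℕ} (α : Form V W G H p q) : RawForm (modelN V W q) (N G H q) p := α.1

/-- The de Rham differential `d_dR : Ω^p(N_q) → Ω^{p+1}(N_q)`. -/
def dForm (p q : ℕ) : Form V W G H p q →ₗ[ℝ] Form V W G H (p + 1) q :=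
  dR (I := modelN V W q) (M := N G H q) (p := p)

/-- The pullback `d_i^* : Ω^p(N_q) → Ω^p(N_{q+1})` along the face map. -/
def coface (p q : ℕ) (i : Fin (q + 2)) : Form V W G H p q →ₗ[ℝ] Form V W G H p (q + 1) :=
  pullback (p := p) (X.face i)

theorem dForm_dForm (p q : ℕ) (α : Form V W G H p q) : dForm (p + 1) q (dForm p q α) = 0 :=
  dR_dR (I := modelN V W q) (M := N G H q) α

theorem dForm_coface (p q : ℕ) (i : Fin (q + 2)) (α : Form V W G H p q) :
    dForm p (q + 1) (X.coface p q i α) = X.coface (p + 1) q i (dForm p q α) :=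
  dR_pullback (X.face i) α

theorem coface_coface (p q : ℕ) {i j : Fin (q + 2)} (hij : i ≤ j) (α : Form V W G H p q) :
    X.coface p (q + 1) j.succ (X.coface p q i α) =
      X.coface p (q + 1) i.castSucc (X.coface p q j α) := by
  have h1 := pullback_comp (X.face i) (X.face j.succ) α
  have h2 := pullback_comp (X.face j) (X.face i.castSucc) α
  rw [X.face_face hij] at h1
  exact h1.trans h2.symm

/-- The simplicial differential `∂ = (-1)^p ∑ (-1)^i d_i^* : Ω^p(N_q) → Ω^p(N_{q+1})`. -/
def del (p q : ℕ) : Form V W G H p q →ₗ[ℝ] Form V W G H p (q + 1) :=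
  (-1 : ℝ) ^ p • ∑ i : Fin (q + 2), (-1 : ℝ) ^ (i : ℕ) • X.coface p q i

theorem del_apply (p q : ℕ) (α : Form V W G H p q) :
    X.del p q α = (-1 : ℝ) ^ p • ∑ i : Fin (q + 2), (-1 : ℝ) ^ (i : ℕ) • X.coface p q i α := by
  simp [del]

theorem del_del (p q : ℕ) (α : Form V W G H p q) : X.del p (q + 1) (X.del p q α) = 0 := by
  have key : ∑ j : Fin (q + 3), (-1 : ℝ) ^ (j : ℕ) • X.coface p (q + 1) j
      (∑ i : Fin (q + 2), (-1 : ℝ) ^ (i : ℕ) • X.coface p q i α) = 0 := by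
    simp only [map_sum, map_smul, Finset.smul_sum, smul_smul, ← pow_add]
    rw [← Finset.sum_product']
    let P := Fin (q + 3) × Fin (q + 2)
    let S : Finset P := {ij : P | (ij.1 : ℕ) ≤ (ij.2 : ℕ)}
    rw [Finset.univ_product_univ, ← Finset.sum_add_sum_compl S, ← eq_neg_iff_add_eq_zero,
      ← Finset.sum_neg_distrib]
    let φ : ∀ ij : P, ij ∈ S → P := fun ij hij =>
      (ij.2.succ, Fin.castLT ij.1 (lt_of_le_of_lt (Finset.mem_filter.mp hij).right ij.2.is_lt))
    apply Finset.sum_bij φ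
    · intro ij hij
      simp_rw [S, φ, Finset.compl_filter, Finset.mem_filter_univ, Fin.val_succ,
        Fin.val_castLT] at hij ⊢
      omega
    · rintro ⟨i, j⟩ hij ⟨i', j'⟩ hij' h
      have e1 : j.succ = j'.succ := congrArg Prod.fst h
      have e2 : i.val = i'.val := congrArg (fun z => z.2.val) h
      exact Prod.ext (Fin.ext e2) (Fin.succ_injective _ e1)
    · rintro ⟨i', j'⟩ hij'
      simp_rw [S, Finset.compl_filter, Finset.mem_filter_univ, not_le] at hij'
      refine ⟨(Fin.castSucc j', i'.pred ?_), ?_, ?_⟩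
      · rintro rfl
        simp only [Fin.val_zero, not_lt_zero] at hij'
      · simp only [S, Finset.mem_filter_univ, Fin.val_castSucc, Fin.val_pred]
        omega
      · simp only [φ, Fin.castLT_castSucc, Fin.succ_pred]
    · rintro ⟨i, j⟩ hij
      have hij' : (i : ℕ) ≤ j := (Finset.mem_filter.mp hij).right
      obtain ⟨k, rfl⟩ : ∃ k : Fin (q + 2), i = k.castSucc :=
        ⟨i.castLT (lt_of_le_of_lt hij' j.is_lt), rfl⟩
      have hkj : k ≤ j := hij'
      simp only [φ, Fin.castLT_castSucc, Fin.val_succ, Fin.val_castSucc]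
      rw [X.coface_coface p q hkj, ← neg_smul]
      congr 1
      ring
  rw [X.del_apply p (q + 1), X.del_apply p q]
  simp only [map_smul]
  have e : ∀ j : Fin (q + 3), (-1 : ℝ) ^ (j : ℕ) • (-1 : ℝ) ^ p • X.coface p (q + 1) j
      (∑ i : Fin (q + 2), (-1 : ℝ) ^ (i : ℕ) • X.coface p q i α) =
      (-1 : ℝ) ^ p • (-1 : ℝ) ^ (j : ℕ) • X.coface p (q + 1) j
      (∑ i : Fin (q + 2), (-1 : ℝ) ^ (i : ℕ) • X.coface p q i α) := fun j => smul_comm _ _ _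
  rw [Finset.sum_congr rfl fun j _ => e j, ← Finset.smul_sum, key, smul_zero, smul_zero]

theorem dForm_del (p q : ℕ) (α : Form V W G H p q) :
    dForm p (q + 1) (X.del p q α) + X.del (p + 1) q (dForm p q α) = 0 := by
  simp only [del_apply, map_smul, map_sum, X.dForm_coface, pow_succ, mul_neg, mul_one, neg_smul]
  exact add_neg_cancel _

variable (V W G H) in
/-- The degree `n` part `⨁_{p + q = n} Ω^p(N_q)` of the total complex. -/
def Tot (n : ℕ) : Type _ := ∀ e : {e : ℕ × ℕ // e.1 + e.2 = n}, Form V W G H e.1.1 e.1.2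

instance (n : ℕ) : AddCommGroup (Tot V W G H n) :=
  inferInstanceAs (AddCommGroup (∀ e : {e : ℕ × ℕ // e.1 + e.2 = n}, Form V W G H e.1.1 e.1.2))

instance (n : ℕ) : Module ℝ (Tot V W G H n) :=
  inferInstanceAs (Module ℝ (∀ e : {e : ℕ × ℕ // e.1 + e.2 = n}, Form V W G H e.1.1 e.1.2))

/-- The component in `Ω^p(N_q)` of `d_dR α`, for `α` of total degree `n`. -/
def dComp (n : ℕ) : ∀ p q : ℕ, p + q = n + 1 → Tot V W G H n → Form V W G H p q
  | 0, _, _, _ => 0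
  | p + 1, q, h, α => dForm p q (α ⟨(p, q), by omega⟩)

/-- The component in `Ω^p(N_q)` of `∂ α`, for `α` of total degree `n`. -/
def delComp (n : ℕ) : ∀ p q : ℕ, p + q = n + 1 → Tot V W G H n → Form V W G H p q
  | _, 0, _, _ => 0
  | p, q + 1, h, α => X.del p q (α ⟨(p, q), by omega⟩)

theorem dComp_add (n p q : ℕ) (h : p + q = n + 1) (α β : Tot V W G H n) :
    dComp n p q h (α + β) = dComp n p q h α + dComp n p q h β := by
  cases p with
  | zero => exact (add_zero 0).symm
  | succ p => exact map_add (dForm p q) _ _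

theorem dComp_smul (n p q : ℕ) (h : p + q = n + 1) (c : ℝ) (α : Tot V W G H n) :
    dComp n p q h (c • α) = c • dComp n p q h α := by
  cases p with
  | zero => exact (smul_zero c).symm
  | succ p => exact map_smul (dForm p q) c _

theorem delComp_add (n p q : ℕ) (h : p + q = n + 1) (α β : Tot V W G H n) :
    X.delComp n p q h (α + β) = X.delComp n p q h α + X.delComp n p q h β := by
  cases q with
  | zero => exact (add_zero 0).symm
  | succ q => exact map_add (X.del p q) _ _

theorem delComp_smul (n p q : ℕ) (h : p + q = n + 1) (c : ℝ) (α : Tot V W G H n) :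
    X.delComp n p q h (c • α) = c • X.delComp n p q h α := by
  cases q with
  | zero => exact (smul_zero c).symm
  | succ q => exact map_smul (X.del p q) c _

/-- The total differential `d_dR + ∂`. -/
def totD (n : ℕ) : Tot V W G H n →ₗ[ℝ] Tot V W G H (n + 1) where
  toFun α e := dComp n e.1.1 e.1.2 e.2 α + X.delComp n e.1.1 e.1.2 e.2 α
  map_add' α β := by
    funext e
    change _ = (dComp n e.1.1 e.1.2 e.2 α + X.delComp n e.1.1 e.1.2 e.2 α) +
      (dComp n e.1.1 e.1.2 e.2 β + X.delComp n e.1.1 e.1.2 e.2 β)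
    rw [dComp_add, delComp_add, add_add_add_comm]
  map_smul' c α := by
    funext e
    change _ = c • (dComp n e.1.1 e.1.2 e.2 α + X.delComp n e.1.1 e.1.2 e.2 α)
    rw [dComp_smul, delComp_smul, smul_add]

theorem totD_totD (n : ℕ) (α : Tot V W G H n) : X.totD (n + 1) (X.totD n α) = 0 := by
  funext e
  obtain ⟨⟨p, q⟩, h⟩ := e
  change dComp (n + 1) p q h (fun e => dComp n e.1.1 e.1.2 e.2 α + X.delComp n e.1.1 e.1.2 e.2 α) +
    X.delComp (n + 1) p q h
      (fun e => dComp n e.1.1 e.1.2 e.2 α + X.delComp n e.1.1 e.1.2 e.2 α) = 0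
  have h1 : ∀ p q (h : p + 1 + (q + 1) = n + 1 + 1),
      dForm p (q + 1) (X.delComp n p (q + 1) (by omega) α) +
        X.del (p + 1) q (dComp n (p + 1) q (by omega) α) = 0 := fun p q h =>
    X.dForm_del p q (α ⟨(p, q), by omega⟩)
  have h2 : ∀ p q (h : p + 1 + q = n + 1 + 1), dForm p q (dComp n p q (by omega) α) = 0 := by
    intro p q h
    cases p with
    | zero => exact map_zero _
    | succ p => exact dForm_dForm _ _ _
  have h3 : ∀ p q (h : p + (q + 1) = n + 1 + 1), X.del p q (X.delComp n p q (by omega) α) = 0 := by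
    intro p q h
    cases q with
    | zero => exact map_zero _
    | succ q => exact X.del_del _ _ _
  cases p with
  | zero =>
    cases q with
    | zero => simp at h
    | succ q =>
      have e0 : X.del 0 q (dComp n 0 q (by simp only at h; omega) α) = 0 := map_zero _
      change 0 + X.del 0 q (dComp n 0 q (by simp only at h; omega) α +
        X.delComp n 0 q (by simp only at h; omega) α) = 0
      rw [map_add, h3 0 q h, e0, add_zero, add_zero]
  | succ p =>
    cases q with
    | zero =>
      have e0 : dForm p 0 (X.delComp n p 0 (by simp only at h; omega) α) = 0 := map_zero _
      change dForm p 0 (dComp n p 0 (by simp only at h; omega) α +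
        X.delComp n p 0 (by simp only at h; omega) α) + 0 = 0
      rw [map_add, h2 p 0 h, e0, add_zero, add_zero]
    | succ q =>
      change dForm p (q + 1) (dComp n p (q + 1) (by simp only at h; omega) α +
        X.delComp n p (q + 1) (by simp only at h; omega) α) +
        X.del (p + 1) q (dComp n (p + 1) q (by simp only at h; omega) α +
        X.delComp n (p + 1) q (by simp only at h; omega) α) = 0
      rw [map_add, map_add, h2 p (q + 1) h, h3 (p + 1) q h, zero_add, add_zero]
      exact h1 p q h

/-- The total complex `(Ω^•_tot([G → H]), d_dR + ∂)` as a cochain complex of real vector spaces. -/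
def totComplex : CochainComplex (ModuleCat ℝ) ℕ :=
  CochainComplex.of (fun n => ModuleCat.of ℝ (Tot V W G H n))
    (fun n => ModuleCat.ofHom (X.totD n)) fun n => by
      ext α : 2
      exact X.totD_totD n α

/-- The identification `N_2 ≅ G × H × H`: a 2-simplex given by `f₀ = edge 1 2`, `f₁ = edge 0 2`,
`f₂ = edge 0 1` and the 2-arrow `α = (g, h) : f₂ * f₀ = h ⇒ f₁` corresponds to `(g, h, f₀)`. -/
def nerveTwo : Diffeomorph (modelN V W 2) (𝓘(ℝ, V).prod (𝓘(ℝ, W).prod 𝓘(ℝ, W)))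
    (N G H 2) (G × H × H) ∞ where
  toFun x := (X.triOf x 0 1 2, X.edgeOf x 0 1 * X.edgeOf x 1 2, X.edgeOf x 1 2)
  invFun y := (![y.2.1 * y.2.2⁻¹, y.2.1 * X.bd y.1], fun _ => y.1)
  left_inv x := by
    refine Prod.ext (funext fun j => ?_) (funext fun e => ?_)
    · fin_cases j
      · simp
        simp [edgeOf, coordEdge, coordTri]
      · have := X.edgeOf_mul x 0 1 2
        simp [this]
        simp [edgeOf, coordEdge, coordTri]
        rfl
    · obtain ⟨⟨a, b⟩, hab⟩ := e
      fin_cases a <;> fin_cases b <;> simp at hab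
      simp [triOf, coordTri, X.one_act]
      rfl
  right_inv y := by
    have e01 : X.edgeOf (q := 2) ((![y.2.1 * y.2.2⁻¹, y.2.1 * X.bd y.1], fun _ => y.1) : N G H 2)
        0 1 = y.2.1 * y.2.2⁻¹ := by
      change 1⁻¹ * (y.2.1 * y.2.2⁻¹) * (X.bd 1)⁻¹ = _
      simp
    have e12 : X.edgeOf (q := 2) ((![y.2.1 * y.2.2⁻¹, y.2.1 * X.bd y.1], fun _ => y.1) : N G H 2)
        1 2 = y.2.2 := by
      change (y.2.1 * y.2.2⁻¹)⁻¹ * (y.2.1 * X.bd y.1) * (X.bd y.1)⁻¹ = _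
      group
    have t : X.triOf (q := 2) ((![y.2.1 * y.2.2⁻¹, y.2.1 * X.bd y.1], fun _ => y.1) : N G H 2)
        0 1 2 = y.1 := by
      change X.act 1 _ * y.1 * 1⁻¹ = _
      simp [X.one_act]
    refine Prod.ext t (Prod.ext ?_ e12)
    simp only [e01, e12, inv_mul_cancel_right]
  contMDiff_toFun := (X.contMDiff_triOf _ _ _).prodMk
    (((X.contMDiff_edgeOf _ _).mul (X.contMDiff_edgeOf _ _)).prodMk (X.contMDiff_edgeOf _ _))
  contMDiff_invFun := by
    have h1 : ContMDiff (𝓘(ℝ, V).prod (𝓘(ℝ, W).prod 𝓘(ℝ, W))) 𝓘(ℝ, V) ∞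
        fun y : G × H × H => y.1 := contMDiff_fst
    have h2 : ContMDiff (𝓘(ℝ, V).prod (𝓘(ℝ, W).prod 𝓘(ℝ, W))) 𝓘(ℝ, W) ∞
        fun y : G × H × H => y.2.1 := contMDiff_fst.comp contMDiff_snd
    have h3 : ContMDiff (𝓘(ℝ, V).prod (𝓘(ℝ, W).prod 𝓘(ℝ, W))) 𝓘(ℝ, W) ∞
        fun y : G × H × H => y.2.2 := contMDiff_snd.comp contMDiff_snd
    refine ContMDiff.prodMk (contMDiff_pi fun j => ?_) (contMDiff_pi fun _ => h1)
    fin_cases j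
    · exact h2.mul h3.inv
    · exact h2.mul (X.contMDiff_bd.comp h1)

variable (V G) in
/-- The left invariant 1-form `ξ^L` on `G` with value `ξ ∈ 𝔤^*` at the identity. -/
def leftInvariantForm (ξ : GroupLieAlgebra 𝓘(ℝ, V) G →L[ℝ] ℝ) : RawForm 𝓘(ℝ, V) G 1 := fun g =>
  ContinuousAlternatingMap.ofSubsingleton ℝ (TangentSpace 𝓘(ℝ, V) g) ℝ (0 : Fin 1)
    ((ξ : V →L[ℝ] ℝ).comp (mfderiv 𝓘(ℝ, V) 𝓘(ℝ, V) (fun x : G => g⁻¹ * x) g : V →L[ℝ] V))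

/-- The space `(𝔤^*)^{𝔤,H}` of linear forms on `𝔤` that are invariant under `𝔤` and `H`. -/
def invDual : Submodule ℝ (GroupLieAlgebra 𝓘(ℝ, V) G →L[ℝ] ℝ) where
  carrier := {ξ | (∀ x y : GroupLieAlgebra 𝓘(ℝ, V) G, ξ ⁅x, y⁆ = 0) ∧
    ∀ (h : H) (x : V), (ξ : V →L[ℝ] ℝ)
      ((mfderiv 𝓘(ℝ, V) 𝓘(ℝ, V) (fun g : G => X.act g h) 1 : V →L[ℝ] V) x) = (ξ : V →L[ℝ] ℝ) x}
  zero_mem' := ⟨fun _ _ => rfl, fun _ _ => rfl⟩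
  add_mem' := fun {ξ β} hξ hβ => ⟨fun x y => by
    rw [add_apply, hξ.1, hβ.1, add_zero], fun h x =>
      congrArg₂ (· + ·) (hξ.2 h x) (hβ.2 h x)⟩
  smul_mem' := fun c ξ hξ => ⟨fun x y => by
    rw [smul_apply, hξ.1, smul_zero], fun h x =>
      congrArg (c • ·) (hξ.2 h x)⟩

end LieCrossedModule
end Nerve
end LieTwo

end

/-! Write `logDeriv ξ f` for the 1-form `ξ(f⁻¹ df)`, the pullback of `ξ^L` along a map `f` to `G`.
Conjugation by `y` on `G` is the action of `bd y`, so an `H`-invariant `ξ` is also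
`Ad(G)`-invariant, and `logDeriv ξ` turns products into sums and inverses into negatives
(`IsInv.logDeriv_mul`, `IsInv.logDeriv_inv`). Closedness of `ξ^L` follows. Inversion pulls `ξ^L`
back to `-ξ^L`, hence `dξ^L` to its negative; but its derivative at `1` is `-id`, which acts
trivially on 2-forms. So `dξ^L` vanishes at `1`, and everywhere by left invariance.

For the simplicial part, apply `logDeriv ξ` to the tetrahedron identity `g_abc^{f_cd} g_acd = g_bcd
g_abd`. If the action factor contributes `logDeriv ξ g_abc` alone, the result is exactly the
alternating sum of the four faces. The obstruction is the derivative `λ_g(w)` at `1`, in direction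
`w`, of the orbit map `h ↦ g^h`, contracted with `ξ`.

For fixed `w`, `g ↦ λ_g(w)` is a homomorphism `G → ℝ`. It is locally constant: pull the closed form
`ξ^L` back along `(g, h) ↦ g^h`; its `G`-component does not depend on `h` by invariance, so
closedness makes its `H`-component independent of `g`, locally. It is therefore trivial on the
identity component, and zero under the first hypothesis. Under the second, every `w` is tangent to
the image of `bd`, along which the orbit maps are conjugations `y⁻¹ g y`, and there `-ξ + 0 + ξ = 0`
(`IsInv.logDeriv_orbit_one_eq_zero`). -/

noncomputable section

namespace LieTwo

/-! ### Logarithmic derivatives contracted with a linear form -/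

section LogDeriv

variable {V : Type*} [NormedAddCommGroup V] [NormedSpace ℝ V]
  {W : Type*} [NormedAddCommGroup W] [NormedSpace ℝ W]
  {G : Type*} [TopologicalSpace G] [ChartedSpace V G] [Group G] [LieGroup 𝓘(ℝ, V) ∞ G]
  {H : Type*} [TopologicalSpace H] [ChartedSpace W H] [Group H] [LieGroup 𝓘(ℝ, W) ∞ H]
  {E : Type*} [NormedAddCommGroup E] [NormedSpace ℝ E] {B : Type*} [TopologicalSpace B]
  {I : ModelWithCorners ℝ E B} {M : Type*} [TopologicalSpace M] [ChartedSpace B M]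
  {E' : Type*} [NormedAddCommGroup E'] [NormedSpace ℝ E'] {B' : Type*} [TopologicalSpace B']
  {I' : ModelWithCorners ℝ E' B'} {M' : Type*} [TopologicalSpace M'] [ChartedSpace B' M']

theorem mdifferentiable_mul_left (g : G) :
    MDifferentiable 𝓘(ℝ, V) 𝓘(ℝ, V) (fun x : G => g * x) :=
  (contMDiff_mul_left (I := 𝓘(ℝ, V)) (n := ∞) (a := g)).mdifferentiable (by simp)

theorem mdifferentiable_mul :
    MDifferentiable (𝓘(ℝ, V).prod 𝓘(ℝ, V)) 𝓘(ℝ, V) (fun x : G × G => x.1 * x.2) :=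
  (contMDiff_mul 𝓘(ℝ, V) ∞).mdifferentiable (by simp)

theorem mdifferentiable_inv : MDifferentiable 𝓘(ℝ, V) 𝓘(ℝ, V) (fun x : G => x⁻¹) :=
  (contMDiff_inv 𝓘(ℝ, V) ∞).mdifferentiable (by simp)

theorem mdifferentiableAt_mul {a b : M → G} {x : M} (ha : MDifferentiableAt I 𝓘(ℝ, V) a x)
    (hb : MDifferentiableAt I 𝓘(ℝ, V) b x) :
    MDifferentiableAt I 𝓘(ℝ, V) (fun y => a y * b y) x :=
  (mdifferentiable_mul (V := V) (G := G) (a x, b x)).comp x (ha.prodMk hb)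

theorem mdifferentiableAt_inv {a : M → G} {x : M} (ha : MDifferentiableAt I 𝓘(ℝ, V) a x) :
    MDifferentiableAt I 𝓘(ℝ, V) (fun y => (a y)⁻¹) x :=
  (mdifferentiable_inv (V := V) (G := G) (a x)).comp x ha

/-- The derivative of `f : M → G` in the model vector spaces. -/
def modelDeriv (I : ModelWithCorners ℝ E B) (f : M → G) (x : M) : E →L[ℝ] V :=
  mfderiv I 𝓘(ℝ, V) f x

/-- The derivative of a product of two maps with value `1`. -/
theorem modelDeriv_mul_of_eq_one {a b : M → G} {x : M}
    (ha : MDifferentiableAt I 𝓘(ℝ, V) a x) (hb : MDifferentiableAt I 𝓘(ℝ, V) b x)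
    (ha1 : a x = 1) (hb1 : b x = 1) :
    modelDeriv (V := V) I (fun y => a y * b y) x = modelDeriv I a x + modelDeriv I b x := by
  refine ContinuousLinearMap.ext fun v => ?_
  have h := mfderiv_comp_apply_of_eq (I := I) x (f := fun y => (a y, b y)) (y := ((1 : G), (1 : G)))
    (mdifferentiable_mul (V := V) (G := G) (1, 1)) (ha.prodMk hb) (by rw [ha1, hb1]) v
  refine h.trans ((mfderiv_prod_eq_add_apply
    (mdifferentiable_mul (V := V) (G := G) (1, 1))).trans ?_)
  -- The two partial derivatives of multiplication at `(1, 1)` are those of `z ↦ z * 1` and `z ↦ 1 *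
  -- z`, both the identity.
  have e1 : modelDeriv 𝓘(ℝ, V) (fun z : G => z * 1) 1 = ContinuousLinearMap.id ℝ V := by
    simp only [mul_one]
    exact mfderiv_id
  have e2 : modelDeriv 𝓘(ℝ, V) (fun z : G => 1 * z) 1 = ContinuousLinearMap.id ℝ V := by
    simp only [one_mul]
    exact mfderiv_id
  have e3 := congrArg (fun l : E →L[ℝ] V × V => l v) (mfderiv_prodMk ha hb)
  exact congrArg₂ (fun p q : V => p + q)
    ((congrArg (fun l : V →L[ℝ] V => l _) e1).trans (congrArg Prod.fst e3))
    ((congrArg (fun l : V →L[ℝ] V => l _) e2).trans (congrArg Prod.snd e3))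

/-- The logarithmic derivative of `f : M → G`, contracted with a linear form on the Lie algebra:
the value at `x` of the pullback along `f` of the left invariant form. -/
def logDeriv (I : ModelWithCorners ℝ E B) (ξ : V →L[ℝ] ℝ) (f : M → G) (x : M) : E →L[ℝ] ℝ :=
  ξ.comp (modelDeriv I (fun y => (f x)⁻¹ * f y) x)

theorem logDeriv_congr {ξ : V →L[ℝ] ℝ} {f g : M → G} {x : M} (h : f =ᶠ[𝓝 x] g) :
    logDeriv I ξ f x = logDeriv I ξ g x := by
  have h' : (fun y => (f x)⁻¹ * f y) =ᶠ[𝓝 x] fun y => (g x)⁻¹ * g y := by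
    filter_upwards [h] with y hy
    rw [hy, h.eq_of_nhds]
  refine ContinuousLinearMap.ext fun v => ?_
  exact congrArg (fun l : E →L[ℝ] V => ξ (l v)) h'.mfderiv_eq

theorem logDeriv_const (ξ : V →L[ℝ] ℝ) (g : G) (x : M) : logDeriv I ξ (fun _ => g) x = 0 := by
  refine ContinuousLinearMap.ext fun v => ?_
  refine (congrArg (fun l : E →L[ℝ] V => ξ (l v)) mfderiv_const).trans (map_zero ξ)

theorem logDeriv_comp {ξ : V →L[ℝ] ℝ} {f : M' → G} {φ : M → M'} {x : M}
    (hf : MDifferentiableAt I' 𝓘(ℝ, V) f (φ x)) (hφ : MDifferentiableAt I I' φ x) :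
    logDeriv I ξ (f ∘ φ) x = (logDeriv I' ξ f (φ x)).comp (mfderiv I I' φ x : E →L[ℝ] E') := by
  refine ContinuousLinearMap.ext fun v => ?_
  exact congrArg ξ (mfderiv_comp_apply (I' := I') x (f := φ) (g := fun y => (f (φ x))⁻¹ * f y)
    ((mdifferentiable_mul_left (V := V) _ _).comp _ hf) hφ v)

theorem logDeriv_mul_left {ξ : V →L[ℝ] ℝ} (g : G) (f : M → G) (x : M) :
    logDeriv I ξ (fun y => g * f y) x = logDeriv I ξ f x := by
  have e : (fun y => (g * f x)⁻¹ * (g * f y)) = fun y => (f x)⁻¹ * f y := by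
    funext y; group
  refine ContinuousLinearMap.ext fun v => ?_
  exact congrArg (fun l : M → G => ξ ((mfderiv I 𝓘(ℝ, V) l x : E →L[ℝ] V) v)) e

/-- A product whose logarithmic derivative is the sum of those of the factors, up to conjugation
of the first one. -/
theorem logDeriv_mul_conj {ξ : V →L[ℝ] ℝ} {f g : M → G} {x : M}
    (hf : MDifferentiableAt I 𝓘(ℝ, V) f x) (hg : MDifferentiableAt I 𝓘(ℝ, V) g x) :
    logDeriv I ξ (fun y => f y * g y) x =
      logDeriv I ξ (fun y => (g x)⁻¹ * f y * g x) x + logDeriv I ξ g x := by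
  have hl : ∀ c : G, MDifferentiableAt I 𝓘(ℝ, V) (fun y => c * f y) x := fun c =>
    (mdifferentiable_mul_left (V := V) c _).comp x hf
  -- Left-translate the product to `1` at `x` and insert `g x * (g x)⁻¹`: both factors then take the
  -- value `1` at `x`, so their derivatives add.
  have h := modelDeriv_mul_of_eq_one (I := I) (V := V)
    (a := fun y => (g x)⁻¹ * ((f x)⁻¹ * f y) * g x) (b := fun y => (g x)⁻¹ * g y) (x := x)
    (mdifferentiableAt_mul (mdifferentiableAt_mul mdifferentiableAt_const (hl _))
      mdifferentiableAt_const)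
    ((mdifferentiable_mul_left (V := V) _ _).comp x hg) (by group) (by group)
  have e1 : (fun y => (g x)⁻¹ * ((f x)⁻¹ * f y) * g x * ((g x)⁻¹ * g y)) =
      fun y => (f x * g x)⁻¹ * (f y * g y) := by
    funext y; group
  have e2 : (fun y => (g x)⁻¹ * ((f x)⁻¹ * f y) * g x) =
      fun y => ((g x)⁻¹ * f x * g x)⁻¹ * ((g x)⁻¹ * f y * g x) := by
    funext y; group
  rw [e1, e2] at h
  refine ContinuousLinearMap.ext fun v => ?_
  exact (congrArg (fun l => ξ (l v)) h).trans (map_add ξ _ _)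

namespace LieCrossedModule

variable (X : LieCrossedModule V W G H)

theorem mdifferentiable_act_left (h : H) :
    MDifferentiable 𝓘(ℝ, V) 𝓘(ℝ, V) (fun g : G => X.act g h) :=
  (X.contMDiff_act.comp (contMDiff_id.prodMk contMDiff_const)).mdifferentiable (by simp)

theorem mdifferentiable_act_right (g : G) :
    MDifferentiable 𝓘(ℝ, W) 𝓘(ℝ, V) (fun h : H => X.act g h) :=
  (X.contMDiff_act.comp (contMDiff_const.prodMk contMDiff_id)).mdifferentiable (by simp)

theorem mdifferentiableAt_act {f : M → G} {h : M → H} {x : M}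
    (hf : MDifferentiableAt I 𝓘(ℝ, V) f x) (hh : MDifferentiableAt I 𝓘(ℝ, W) h x) :
    MDifferentiableAt I 𝓘(ℝ, V) (fun y => X.act (f y) (h y)) x :=
  (X.contMDiff_act.mdifferentiable (by simp) (f x, h x)).comp x (hf.prodMk hh)

/-- Invariance of a linear form on the Lie algebra of `G` under `H`. -/
def IsInv (ξ : V →L[ℝ] ℝ) : Prop :=
  ∀ (h : H) (v : V),
    ξ ((mfderiv 𝓘(ℝ, V) 𝓘(ℝ, V) (fun g : G => X.act g h) 1 : V →L[ℝ] V) v) = ξ v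

variable {X} {ξ : V →L[ℝ] ℝ}
-- A fixed `h` acts by an automorphism of `G`, so it commutes with the left translation to `1`; the
-- chain rule then leaves its derivative at `1`, which `ξ` does not see.
theorem IsInv.logDeriv_act_const (hξ : X.IsInv ξ) {f : M → G} {x : M} (hf : MDifferentiableAt I 𝓘(ℝ, V) f x)
    (h : H) : logDeriv I ξ (fun y => X.act (f y) h) x = logDeriv I ξ f x := by
  have e : (fun y => (X.act (f x) h)⁻¹ * X.act (f y) h) =
      (fun g => X.act g h) ∘ fun y => (f x)⁻¹ * f y := by
    funext y
    simp [X.mul_act, X.inv_act]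
  refine ContinuousLinearMap.ext fun v => ?_
  refine (congrArg (fun l : M → G => ξ ((mfderiv I 𝓘(ℝ, V) l x : E →L[ℝ] V) v)) e).trans ?_
  refine (congrArg ξ (mfderiv_comp_apply_of_eq (I := I) x (f := fun y => (f x)⁻¹ * f y)
    (y := (1 : G)) (X.mdifferentiable_act_left h 1)
    ((mdifferentiable_mul_left (V := V) _ _).comp x hf) (by simp) v)).trans ?_
  exact hξ h _

/-- The conjugation of `f` by `g x` in `logDeriv_mul_conj` is the action of the constant `bd (g x)`,
which is absorbed by invariance. This is where the Peiffer identity `act_bd` makes `H`-invariance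
suffice. -/
theorem IsInv.logDeriv_mul (hξ : X.IsInv ξ) {f g : M → G} {x : M}
    (hf : MDifferentiableAt I 𝓘(ℝ, V) f x) (hg : MDifferentiableAt I 𝓘(ℝ, V) g x) :
    logDeriv I ξ (fun y => f y * g y) x = logDeriv I ξ f x + logDeriv I ξ g x := by
  rw [logDeriv_mul_conj hf hg]
  congr 1
  simp only [← X.act_bd]
  exact hξ.logDeriv_act_const hf _

theorem IsInv.logDeriv_inv (hξ : X.IsInv ξ) {f : M → G} {x : M} (hf : MDifferentiableAt I 𝓘(ℝ, V) f x) :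
    logDeriv I ξ (fun y => (f y)⁻¹) x = -logDeriv I ξ f x := by
  have h := hξ.logDeriv_mul hf (mdifferentiableAt_inv hf)
  simp only [mul_inv_cancel, logDeriv_const] at h
  exact (neg_eq_of_add_eq_zero_right h.symm).symm

end LieCrossedModule

end LogDeriv

/-! ### Smoothness and closedness of the left invariant form -/

section LeftInvariantForm

open LieCrossedModule (leftInvariantForm)

variable {V : Type*} [NormedAddCommGroup V] [NormedSpace ℝ V]
  {W : Type*} [NormedAddCommGroup W] [NormedSpace ℝ W]
  {G : Type*} [TopologicalSpace G] [ChartedSpace V G] [Group G] [LieGroup 𝓘(ℝ, V) ∞ G]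
  {H : Type*} [TopologicalSpace H] [ChartedSpace W H] [Group H] [LieGroup 𝓘(ℝ, W) ∞ H]
  {E : Type*} [NormedAddCommGroup E] [NormedSpace ℝ E] {B : Type*} [TopologicalSpace B]
  {I : ModelWithCorners ℝ E B} {M : Type*} [TopologicalSpace M] [ChartedSpace B M]

/-- This dictionary lets identities between pullbacks of `ξ^L` be proved through the calculus of
`logDeriv`. -/
theorem rawPullback_leftInvariantForm (ξ : V →L[ℝ] ℝ) {f : M → G} {x : M}
    (hf : MDifferentiableAt I 𝓘(ℝ, V) f x) :
    rawPullback (I := I) f (leftInvariantForm V G ξ) x =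
      ContinuousAlternatingMap.ofSubsingleton ℝ E ℝ (0 : Fin 1) (logDeriv I ξ f x) := by
  refine ContinuousAlternatingMap.ext fun v => ?_
  exact (congrArg ξ (mfderiv_comp_apply (I' := 𝓘(ℝ, V)) x (f := f) (g := fun y => (f x)⁻¹ * y)
    (mdifferentiable_mul_left (V := V) _ _) hf (v 0))).symm

theorem isSmoothForm_leftInvariantForm (ξ : V →L[ℝ] ℝ) :
    IsSmoothForm (leftInvariantForm V G ξ) := by
  intro x₀ y hy
  set φ := (extChartAt 𝓘(ℝ, V) x₀).symm
  set ψ := extChartAt 𝓘(ℝ, V) (1 : G)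
  -- In charts the form at `z` is `ξ` composed with the partial derivative of this two-variable map
  -- in its second variable, taken on the diagonal; joint smoothness makes it smooth in `z`.
  have hF : ContDiffAt ℝ ∞ (Function.uncurry fun z z' => ψ ((φ z)⁻¹ * φ z')) (y, y) := by
    rw [← contMDiffAt_iff_contDiffAt]
    have h1 : ContMDiffAt 𝓘(ℝ, V × V) 𝓘(ℝ, V) ∞ (fun z : V × V => φ z.1) (y, y) :=
      (contMDiffAt_symm hy).comp (y, y) contDiff_fst.contMDiff.contMDiffAt
    have h2 : ContMDiffAt 𝓘(ℝ, V × V) 𝓘(ℝ, V) ∞ (fun z : V × V => φ z.2) (y, y) :=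
      (contMDiffAt_symm hy).comp (y, y) contDiff_snd.contMDiff.contMDiffAt
    refine ContMDiffAt.comp_of_eq (y := (1 : G)) (contMDiffAt_extChartAt) (h1.inv.mul h2) ?_
    exact inv_mul_cancel _
  have hd : ContDiffAt ℝ ∞ (fun z => fderiv ℝ (fun z' => ψ ((φ z)⁻¹ * φ z')) z) y :=
    ContDiffAt.fderiv (f := fun z z' => ψ ((φ z)⁻¹ * φ z')) (g := fun z => z) hF contDiffAt_id
      (by simp)
  have hs : ContDiffAt ℝ ∞ (fun z => ContinuousAlternatingMap.ofSubsingletonLIE (𝕜 := ℝ) (E := V) (F := ℝ) (0 : Fin 1)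
      (ξ.comp (fderiv ℝ (fun z' => ψ ((φ z)⁻¹ * φ z')) z))) y :=
    (ContinuousAlternatingMap.ofSubsingletonLIE (𝕜 := ℝ) (E := V) (F := ℝ) (0 : Fin 1)).contDiff.contDiffAt.comp y
      (contDiffAt_const.clm_comp hd)
  refine (hs.congr_of_eventuallyEq ?_).contDiffWithinAt
  filter_upwards [(isOpen_extChartAt_target (I := 𝓘(ℝ, V)) x₀).mem_nhds hy] with z hz
  have hφ : MDifferentiableAt 𝓘(ℝ, V) 𝓘(ℝ, V) φ z := (contMDiffAt_symm hz).mdifferentiableAt (by simp)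
  refine (rawPullback_leftInvariantForm ξ hφ).trans ?_
  -- Reading values near `1` in the chart at `1` does not change the derivative, since that chart
  -- has derivative the identity at its base point.
  have e : fderiv ℝ (fun z' => ψ ((φ z)⁻¹ * φ z')) z =
      modelDeriv 𝓘(ℝ, V) (fun z' => (φ z)⁻¹ * φ z') z := by
    refine ContinuousLinearMap.ext fun v => ?_
    rw [← mfderiv_eq_fderiv]
    refine (mfderiv_comp_apply_of_eq (I' := 𝓘(ℝ, V)) z (f := fun z' => (φ z)⁻¹ * φ z') (g := ψ)
      (y := (1 : G)) (mdifferentiableAt_extChartAt (mem_chart_source V _))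
      ((mdifferentiable_mul_left (V := V) _ _).comp z hφ) (inv_mul_cancel _) v).trans ?_
    exact congrArg (fun l : V →L[ℝ] V => l _) (mfderiv_extChartAt_self (I := 𝓘(ℝ, V)) (x := (1 : G)))
  rw [e]
  rfl

theorem rawExtDeriv_neg {p : ℕ} [I.Boundaryless] [IsManifold I ∞ M] {α : RawForm I M p}
    (hα : IsSmoothForm α) : rawExtDeriv (-α) = -rawExtDeriv α :=
  congrArg Subtype.val (map_neg (dR (I := I) (M := M) (p := p)) (⟨α, hα⟩ : DForm I M p))

/-- The two signs cancel, since a 2-form has even degree; on 1-forms `-id` would act by `-1`. -/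
theorem alternating_two_neg (f : V [⋀^Fin 2]→L[ℝ] ℝ) (v : Fin 2 → V) :
    f (fun i => (-ContinuousLinearMap.id ℝ V : V →L[ℝ] V) (v i)) = f v := by
  simpa using f.toMultilinearMap.map_smul_univ (fun _ => (-1 : ℝ)) v

/-- Differentiate `x * x⁻¹ = 1` at the identity. -/
theorem modelDeriv_inv_one :
    modelDeriv 𝓘(ℝ, V) (fun x : G => x⁻¹) 1 = -ContinuousLinearMap.id ℝ V := by
  have h := modelDeriv_mul_of_eq_one (V := V) (I := 𝓘(ℝ, V)) (a := fun x : G => x)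
    (b := fun x : G => x⁻¹) (x := 1) mdifferentiableAt_id (mdifferentiable_inv _) rfl inv_one
  have e1 : modelDeriv 𝓘(ℝ, V) (fun x : G => x) 1 = ContinuousLinearMap.id ℝ V := mfderiv_id
  have e2 : modelDeriv 𝓘(ℝ, V) (fun x : G => x * x⁻¹) 1 = (0 : V →L[ℝ] V) := by
    simp only [mul_inv_cancel]
    exact mfderiv_const
  rw [e1, e2] at h
  exact (neg_eq_of_add_eq_zero_right h.symm).symm

namespace LieCrossedModule

variable {X : LieCrossedModule V W G H} {ξ : V →L[ℝ] ℝ}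

/-- The left invariant form of an invariant linear form is closed. -/
theorem IsInv.rawExtDeriv_leftInvariantForm (hξ : X.IsInv ξ) :
    rawExtDeriv (leftInvariantForm V G ξ) = 0 := by
  have hs := isSmoothForm_leftInvariantForm (G := G) ξ
  set η := rawExtDeriv (leftInvariantForm V G ξ) with hη
  have h1 : rawPullback (fun x : G => x⁻¹) η = -η := by
    rw [hη, ← hs.d_pullback (contMDiff_inv 𝓘(ℝ, V) ∞), ← rawExtDeriv_neg hs]
    congr 1
    funext g
    rw [rawPullback_leftInvariantForm ξ (mdifferentiable_inv (V := V) g),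
      hξ.logDeriv_inv (f := fun x => x) mdifferentiableAt_id]
    exact map_neg (ContinuousAlternatingMap.ofSubsingletonLIE (𝕜 := ℝ) (E := V) (F := ℝ) (0 : Fin 1)) _
  -- The base point is kept as a variable equal to `1`, because the statement is later needed at
  -- `g⁻¹ * g`.
  have h2 : ∀ g : G, g = 1 → η g = 0 := by
    rintro _ rfl
    let ζ : G → V [⋀^Fin 2]→L[ℝ] ℝ := η
    refine ContinuousAlternatingMap.ext fun (v : Fin 2 → V) => ?_
    have h3 := congrArg (fun l : V [⋀^Fin 2]→L[ℝ] ℝ => l v) (congrFun h1 1)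
    -- The pullback along inversion evaluates the form at `1⁻¹`. All tangent spaces are the model
    -- space `V`, so the values at `1⁻¹` and `1` can be compared there.
    have h4 : ∀ a : G, a = 1 → ∀ w : Fin 2 → V, ζ a w =
        ζ 1 w := by
      rintro _ rfl w
      rfl
    have h5 : ζ 1
        (fun i => modelDeriv 𝓘(ℝ, V) (fun x : G => x⁻¹) 1 (v i)) = -ζ 1 v :=
      (h4 _ inv_one _).symm.trans h3
    rw [modelDeriv_inv_one] at h5
    have h6 := alternating_two_neg (ζ 1) v
    have h7 : ζ 1 v = -ζ 1 v := h6.symm.trans h5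
    exact self_eq_neg.1 h7
  funext g
  -- `ξ^L` is left invariant and `d` commutes with pullback, so `η` is left invariant; its value at
  -- `g` is the one at `g⁻¹ * g = 1`, pulled back.
  have h3 : rawPullback (fun x : G => g⁻¹ * x) η = η := by
    rw [hη, ← hs.d_pullback contMDiff_mul_left]
    congr 1
    funext x
    rw [rawPullback_leftInvariantForm ξ (mdifferentiable_mul_left (V := V) _ x),
      logDeriv_mul_left g⁻¹ (fun x => x)]
    rfl
  rw [← h3]
  unfold rawPullback
  rw [h2 _ (inv_mul_cancel g)]
  rfl

end LieCrossedModule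

end LeftInvariantForm

namespace LieCrossedModule

/-! ### Logarithmic derivatives of the orbit maps `h ↦ g^h` -/

section Orbit

variable {V : Type*} [NormedAddCommGroup V] [NormedSpace ℝ V]
  {W : Type*} [NormedAddCommGroup W] [NormedSpace ℝ W]
  {G : Type*} [TopologicalSpace G] [ChartedSpace V G] [Group G] [LieGroup 𝓘(ℝ, V) ∞ G]
  {H : Type*} [TopologicalSpace H] [ChartedSpace W H] [Group H] [LieGroup 𝓘(ℝ, W) ∞ H]
  {E : Type*} [NormedAddCommGroup E] [NormedSpace ℝ E] {B : Type*} [TopologicalSpace B]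
  {I : ModelWithCorners ℝ E B} {M : Type*} [TopologicalSpace M] [ChartedSpace B M]
  {E' : Type*} [NormedAddCommGroup E'] [NormedSpace ℝ E'] {B' : Type*} [TopologicalSpace B']
  {I' : ModelWithCorners ℝ E' B'} {M' : Type*} [TopologicalSpace M'] [ChartedSpace B' M']
  {X : LieCrossedModule V W G H} {ξ : V →L[ℝ] ℝ}

theorem logDeriv_prod {f : M × M' → G} {p : M × M'}
    (hf : MDifferentiableAt (I.prod I') 𝓘(ℝ, V) f p) (v : E × E') :
    logDeriv (I.prod I') ξ f p v = logDeriv I ξ (fun z => f (z, p.2)) p.1 v.1 +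
      logDeriv I' ξ (fun z => f (p.1, z)) p.2 v.2 :=
  (congrArg ξ (mfderiv_prod_eq_add_apply (f := fun y => (f p)⁻¹ * f y)
    ((mdifferentiable_mul_left (V := V) _ _).comp _ hf))).trans (map_add ξ _ _)

/-- Since `H` acts by automorphisms, the orbit map of a product is the product of the orbit maps.
This is what makes the obstruction to the cocycle equation a homomorphism on `G`. -/
theorem IsInv.logDeriv_orbit_mul (hξ : X.IsInv ξ) (g g' : G) :
    logDeriv 𝓘(ℝ, W) ξ (fun h => X.act (g * g') h) 1 =
      logDeriv 𝓘(ℝ, W) ξ (fun h => X.act g h) 1 + logDeriv 𝓘(ℝ, W) ξ (fun h => X.act g' h) 1 := by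
  simp only [X.mul_act]
  exact hξ.logDeriv_mul (X.mdifferentiable_act_right g 1) (X.mdifferentiable_act_right g' 1)

/-- The orbit maps of `G` under the image of `G` in `H` are conjugations, on which the
logarithmic derivative vanishes. -/
theorem IsInv.logDeriv_orbit_mfderiv_bd (hξ : X.IsInv ξ) (g : G) (v : V) :
    logDeriv 𝓘(ℝ, W) ξ (fun h => X.act g h) 1
      ((mfderiv 𝓘(ℝ, V) 𝓘(ℝ, W) X.bd 1 : V →L[ℝ] W) v) = 0 := by
  have hb : MDifferentiableAt 𝓘(ℝ, V) 𝓘(ℝ, W) X.bd 1 :=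
    X.contMDiff_bd.mdifferentiable (by simp) 1
  have h1 := logDeriv_comp (I := 𝓘(ℝ, V)) (I' := 𝓘(ℝ, W)) (ξ := ξ) (f := fun h => X.act g h)
    (φ := X.bd) (x := 1) (X.mdifferentiable_act_right g _) hb
  have e : (fun h => X.act g h) ∘ X.bd = fun y : G => y⁻¹ * g * y := by
    funext y
    exact X.act_bd g y
  have hi : MDifferentiableAt 𝓘(ℝ, V) 𝓘(ℝ, V) (fun y : G => y) 1 := mdifferentiableAt_id
  -- For `y⁻¹ * g * y` the contributions are `-ξ`, `0` and `ξ`.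
  rw [e, hξ.logDeriv_mul (mdifferentiableAt_mul (mdifferentiableAt_inv hi) mdifferentiableAt_const)
    hi, hξ.logDeriv_mul (mdifferentiableAt_inv hi) mdifferentiableAt_const, hξ.logDeriv_inv hi,
    logDeriv_const, add_zero, neg_add_cancel] at h1
  have h2 : ∀ a : H, a = 1 → logDeriv 𝓘(ℝ, W) ξ (fun h => X.act g h) a =
    logDeriv 𝓘(ℝ, W) ξ (fun h => X.act g h) 1 := by
    rintro _ rfl
    rfl
  rw [← h2 _ (map_one X.bd)]
  exact (congrArg (fun l : V →L[ℝ] ℝ => l v) h1).symm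

/-- If the logarithmic derivatives of the orbit maps vanish at the identity, then they vanish. -/
theorem logDeriv_orbit_eq_zero
    (h0 : ∀ g : G, logDeriv 𝓘(ℝ, W) ξ (fun h => X.act g h) 1 = 0) (g : G) (k : H) :
    logDeriv 𝓘(ℝ, W) ξ (fun h => X.act g h) k = 0 := by
  -- Near `k`, the orbit map of `g` is the orbit map of `g^k` near `1`, after translation by `k⁻¹`;
  -- the hypothesis at `1` is needed for all elements of `G` at once.
  have e : (fun h => X.act g h) = (fun h => X.act (X.act g k) h) ∘ fun h => k⁻¹ * h := by
    funext h
    simp [← X.act_mul]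
  have h2 : ∀ a : H, a = 1 → logDeriv 𝓘(ℝ, W) ξ (fun h => X.act (X.act g k) h) a = 0 := by
    rintro _ rfl
    exact h0 _
  rw [e, logDeriv_comp (I' := 𝓘(ℝ, W)) (X.mdifferentiable_act_right _ _)
    (mdifferentiable_mul_left (V := W) _ _), h2 _ (inv_mul_cancel k)]
  rfl

/-- By the chain rule the derivative of `(g, h) ↦ g^h` splits into partials: the one in `g` is
preserved by invariance, the one in `h` is an orbit derivative and vanishes. -/
theorem IsInv.logDeriv_act (hξ : X.IsInv ξ)
    (h0 : ∀ g : G, logDeriv 𝓘(ℝ, W) ξ (fun h => X.act g h) 1 = 0)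
    {f : M → G} {k : M → H} {x : M} (hf : MDifferentiableAt I 𝓘(ℝ, V) f x)
    (hk : MDifferentiableAt I 𝓘(ℝ, W) k x) :
    logDeriv I ξ (fun y => X.act (f y) (k y)) x = logDeriv I ξ f x := by
  have ha : MDifferentiableAt (𝓘(ℝ, V).prod 𝓘(ℝ, W)) 𝓘(ℝ, V) (fun p : G × H => X.act p.1 p.2)
    (f x, k x) := X.contMDiff_act.mdifferentiable (by simp) _
  have h1 := logDeriv_comp (I := I) (ξ := ξ) (f := fun p : G × H => X.act p.1 p.2)
    (φ := fun y => (f y, k y)) (x := x) ha (hf.prodMk hk)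
  -- `f` is written as `id ∘ f`, so that both sides are values of forms on `G` at the derivative of
  -- `f`.
  have h2 := logDeriv_comp (I := I) (I' := 𝓘(ℝ, V)) (ξ := ξ) (f := fun g : G => g) (φ := f) (x := x)
    mdifferentiableAt_id hf
  refine h1.trans (Eq.trans ?_ h2.symm)
  refine ContinuousLinearMap.ext fun v => ?_
  refine (logDeriv_prod ha _).trans ?_
  rw [hξ.logDeriv_act_const (f := fun g : G => g) mdifferentiableAt_id, logDeriv_orbit_eq_zero h0]
  refine (add_zero _).trans ?_
  exact congrArg (fun l : E →L[ℝ] V × W => logDeriv 𝓘(ℝ, V) ξ (fun g : G => g) (f x) (l v).1)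
    (mfderiv_prodMk hf hk)

end Orbit

end LieCrossedModule

namespace LieCrossedModule

/-! ### Vanishing of the orbit derivatives -/

section LocallyConstant

variable {V : Type*} [NormedAddCommGroup V] [NormedSpace ℝ V]
  {W : Type*} [NormedAddCommGroup W] [NormedSpace ℝ W]
  {G : Type*} [TopologicalSpace G] [ChartedSpace V G] [Group G] [LieGroup 𝓘(ℝ, V) ∞ G]
  {H : Type*} [TopologicalSpace H] [ChartedSpace W H] [Group H] [LieGroup 𝓘(ℝ, W) ∞ H]
  {X : LieCrossedModule V W G H} {ξ : V →L[ℝ] ℝ}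

theorem differentiableAt_alternating_apply {Ω : V → V [⋀^Fin 1]→L[ℝ] ℝ} {u : V}
    (hd : DifferentiableAt ℝ Ω u) (m : Fin 1 → V) : DifferentiableAt ℝ (fun p => Ω p m) u :=
  (ContinuousAlternatingMap.apply ℝ V ℝ m).differentiableAt.comp u hd

/-- For a closed 1-form on a product, a component along the second factor varies along the first
factor as the corresponding component along the first factor varies along the second one. -/
theorem fderiv_snd_component_eq_zero {Ω : V × W → (V × W) [⋀^Fin 1]→L[ℝ] ℝ} {u : V} {k : W}
    (hd : DifferentiableAt ℝ Ω (u, k)) (hc : extDeriv Ω (u, k) = 0) (v : V) (w : W)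
    (h : ∀ᶠ k' in 𝓝 k, Ω (u, k') (fun _ => (v, 0)) = Ω (u, k) (fun _ => (v, 0))) :
    fderiv ℝ (fun u' => Ω (u', k) (fun _ => (0, w))) u v = 0 := by
  have hap : ∀ m : Fin 1 → V × W, DifferentiableAt ℝ (fun p => Ω p m) (u, k) := 
    differentiableAt_alternating_apply hd
  -- On constant vectors, `dΩ((v,0), (0,w)) = 0` says that the derivative along `(v,0)` of the
  -- `w`-component equals the derivative along `(0,w)` of the `v`-component.
  have h1 := (extDeriv_apply hd ![(v, 0), (0, w)]).symm.trans
    (congrArg (fun l => l ![(v, 0), (0, w)]) hc)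
  replace h1 := (Fin.sum_univ_two _).symm.trans h1
  have e0 : (0 : Fin 2).removeNth ![((v, 0) : V × W), (0, w)] = fun _ => (0, w) := by
    funext i
    fin_cases i
    rfl
  have e1 : (1 : Fin 2).removeNth ![((v, 0) : V × W), (0, w)] = fun _ => (v, 0) := by
    funext i
    fin_cases i
    rfl
  simp only [e0, e1] at h1
  have h2 : fderiv ℝ (fun k' => Ω (u, k') (fun _ => (v, 0))) k w =
      fderiv ℝ (fun p => Ω p (fun _ => (v, 0))) (u, k) (0, w) := by
    exact congrArg (fun l => l w)
      ((hap _).hasFDerivAt.comp (f := fun k' => (u, k')) k (hasFDerivAt_prodMk_right u k)).fderiv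
  have h3 : fderiv ℝ (fun u' => Ω (u', k) (fun _ => (0, w))) u v =
      fderiv ℝ (fun p => Ω p (fun _ => (0, w))) (u, k) (v, 0) := by
    exact congrArg (fun l => l v)
      ((hap _).hasFDerivAt.comp (f := fun u' => (u', k)) u (hasFDerivAt_prodMk_left u k)).fderiv
  -- By `h`, the `v`-component is constant in the second variable near `k`.
  have h4 : fderiv ℝ (fun k' => Ω (u, k') (fun _ => (v, 0))) k = 0 := by
    rw [Filter.EventuallyEq.fderiv_eq (f₁ := fun k' => Ω (u, k') (fun _ => (v, 0)))
      (f := fun _ => Ω (u, k) (fun _ => (v, 0))) h]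
    exact (hasFDerivAt_const _ _).fderiv
  rw [h4] at h2
  rw [h3]
  simpa [← h2] using h1

/-- The logarithmic derivatives of the orbit maps depend in a locally constant way on the point. -/
theorem IsInv.isLocallyConstant_logDeriv_orbit_chart (hξ : X.IsInv ξ) (w : W) :
    IsLocallyConstant fun g : G => logDeriv 𝓘(ℝ, W) ξ
      (fun k => X.act g ((extChartAt 𝓘(ℝ, W) (1 : H)).symm k)) (extChartAt 𝓘(ℝ, W) (1 : H) 1) w := by
  rw [IsLocallyConstant.iff_eventually_eq]
  intro g₀
  set κ := (extChartAt 𝓘(ℝ, W) (1 : H)).symm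
  set k₁ := extChartAt 𝓘(ℝ, W) (1 : H) 1
  set φ := (extChartAt 𝓘(ℝ, V) g₀).symm
  set u₀ := extChartAt 𝓘(ℝ, V) g₀ g₀
  set T := (extChartAt 𝓘(ℝ, V) g₀).target
  have hT : IsOpen T := isOpen_extChartAt_target g₀
  have hk₁ : k₁ ∈ (extChartAt 𝓘(ℝ, W) (1 : H)).target := mem_extChartAt_target _
  have hκs : ∀ k ∈ (extChartAt 𝓘(ℝ, W) (1 : H)).target, ContMDiffAt 𝓘(ℝ, W) 𝓘(ℝ, W) ∞ κ k :=
    fun k hk => contMDiffAt_symm hk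
  have hφs : ∀ u ∈ T, ContMDiffAt 𝓘(ℝ, V) 𝓘(ℝ, V) ∞ φ u := fun u hu => contMDiffAt_symm hu
  -- The action map `(g, h) ↦ g^h` in charts at `g₀` and `1`. The pulled-back form then lives on the
  -- vector space `V × W`, where exterior derivatives are explicit.
  let Ψ : V × W → G := fun p => X.act (φ p.1) (κ p.2)
  have hΨ : ∀ u ∈ T, ∀ k ∈ (extChartAt 𝓘(ℝ, W) (1 : H)).target,
      ContMDiffAt 𝓘(ℝ, V × W) 𝓘(ℝ, V) ∞ Ψ (u, k) := by
    intro u hu k hk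
    have h1 : ContMDiffAt 𝓘(ℝ, V × W) 𝓘(ℝ, V) ∞ (fun p : V × W => φ p.1) (u, k) :=
      (hφs u hu).comp (u, k) contDiff_fst.contMDiff.contMDiffAt
    have h2 : ContMDiffAt 𝓘(ℝ, V × W) 𝓘(ℝ, W) ∞ (fun p : V × W => κ p.2) (u, k) :=
      (hκs k hk).comp (u, k) contDiff_snd.contMDiff.contMDiffAt
    exact (X.contMDiff_act _).comp (u, k) (h1.prodMk h2)
  have hs := isSmoothForm_leftInvariantForm (G := G) ξ
  let Ω : V × W → (V × W) [⋀^Fin 1]→L[ℝ] ℝ := vecPullback Ψ (leftInvariantForm V G ξ)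
  have hΩ : ∀ u ∈ T, ∀ k ∈ (extChartAt 𝓘(ℝ, W) (1 : H)).target, ∀ c : V × W,
      Ω (u, k) (fun _ => c) = logDeriv 𝓘(ℝ, V × W) ξ Ψ (u, k) c := fun u hu k hk c =>
    congrArg (fun l : (V × W) [⋀^Fin 1]→L[ℝ] ℝ => l fun _ => c)
      (rawPullback_leftInvariantForm ξ ((hΨ u hu k hk).mdifferentiableAt (by simp)))
  have hd : ∀ u ∈ T, DifferentiableAt ℝ Ω (u, k₁) := fun u hu =>
    (hs.contDiffAt_vecPullback (hΨ u hu k₁ hk₁)).differentiableAt (by simp)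
  have hc : ∀ u ∈ T, extDeriv Ω (u, k₁) = 0 := by
    intro u hu
    refine (hs.extDeriv_vecPullback (hΨ u hu k₁ hk₁)).trans ?_
    rw [hξ.rawExtDeriv_leftInvariantForm]
    rfl
  -- With `k` frozen, `Ψ` is `φ` followed by the action of the constant `κ k`, which invariance
  -- removes; the right-hand side does not involve `k`.
  have hV : ∀ u ∈ T, ∀ k ∈ (extChartAt 𝓘(ℝ, W) (1 : H)).target, ∀ v : V,
      Ω (u, k) (fun _ => (v, 0)) = logDeriv 𝓘(ℝ, V) ξ φ u v := by
    intro u hu k hk v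
    rw [hΩ u hu k hk, ← hξ.logDeriv_act_const ((hφs u hu).mdifferentiableAt (by simp)) (κ k)]
    have h := logDeriv_comp (I := 𝓘(ℝ, V)) (I' := 𝓘(ℝ, V × W)) (ξ := ξ) (f := Ψ)
      (φ := fun u' => (u', k)) (x := u) ((hΨ u hu k hk).mdifferentiableAt (by simp))
      (hasFDerivAt_prodMk_left u k).hasMFDerivAt.mdifferentiableAt
    rw [(hasFDerivAt_prodMk_left u k).hasMFDerivAt.mfderiv] at h
    exact (congrArg (fun l => l v) h).symm
  have hW : ∀ u ∈ T, Ω (u, k₁) (fun _ => (0, w)) =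
      logDeriv 𝓘(ℝ, W) ξ (fun k => X.act (φ u) (κ k)) k₁ w := by
    intro u hu
    rw [hΩ u hu k₁ hk₁]
    have h := logDeriv_comp (I := 𝓘(ℝ, W)) (I' := 𝓘(ℝ, V × W)) (ξ := ξ) (f := Ψ)
      (φ := fun k => (u, k)) (x := k₁) ((hΨ u hu k₁ hk₁).mdifferentiableAt (by simp))
      (hasFDerivAt_prodMk_right u k₁).hasMFDerivAt.mdifferentiableAt
    rw [(hasFDerivAt_prodMk_right u k₁).hasMFDerivAt.mfderiv] at h
    exact (congrArg (fun l => l w) h).symm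
  have hz : ∀ u ∈ T, fderiv ℝ (fun u' => Ω (u', k₁) (fun _ => (0, w))) u = 0 := by
    intro u hu
    refine ContinuousLinearMap.ext fun v => ?_
    refine fderiv_snd_component_eq_zero (hd u hu) (hc u hu) v w ?_
    filter_upwards [(isOpen_extChartAt_target (I := 𝓘(ℝ, W)) (1 : H)).mem_nhds hk₁] with k hk
    rw [hV u hu k hk, hV u hu k₁ hk₁]
  have hf : ∀ u ∈ T, DifferentiableAt ℝ (fun u' => Ω (u', k₁) (fun _ => (0, w))) u := by
    intro u hu
    have h : DifferentiableAt ℝ (fun p => Ω p (fun _ => (0, w))) (u, k₁) :=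
      differentiableAt_alternating_apply (hd u hu) _
    exact h.comp (f := fun u' => (u', k₁)) u (hasFDerivAt_prodMk_left u k₁).differentiableAt
  have hu₀ : u₀ ∈ T := mem_extChartAt_target _
  -- A ball is convex, hence preconnected, so the vanishing derivative makes the component constant
  -- on it.
  obtain ⟨ε, hε, hB⟩ := Metric.isOpen_iff.1 hT u₀ hu₀
  have hg : ∀ᶠ g in 𝓝 g₀, extChartAt 𝓘(ℝ, V) g₀ g ∈ Metric.ball u₀ ε :=
    (continuousAt_extChartAt g₀).eventually (Metric.ball_mem_nhds u₀ hε)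
  filter_upwards [hg, extChartAt_source_mem_nhds (I := 𝓘(ℝ, V)) g₀] with g hg hgs
  have h1 := Metric.isOpen_ball.is_const_of_fderiv_eq_zero (𝕜 := ℝ)
    (convex_ball u₀ ε).isPreconnected
    (f := fun u' => Ω (u', k₁) (fun _ => (0, w)))
    (fun u hu => (hf u (hB hu)).differentiableWithinAt)
    (fun u hu => hz u (hB hu)) hg (Metric.mem_ball_self hε)
  simp only [hW _ (hB hg), hW _ hu₀] at h1
  have e1 : φ (extChartAt 𝓘(ℝ, V) g₀ g) = g := (extChartAt 𝓘(ℝ, V) g₀).left_inv hgs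
  have e2 : φ u₀ = g₀ := extChartAt_to_inv g₀
  rwa [e1, e2] at h1

/-- The logarithmic derivative of the orbit map at the identity, read in the chart at `1 : H`. -/
theorem logDeriv_orbit_eq_comp_chart (g : G) (w : W) :
    logDeriv 𝓘(ℝ, W) ξ (fun h => X.act g h) 1 w = logDeriv 𝓘(ℝ, W) ξ
      (fun k => X.act g ((extChartAt 𝓘(ℝ, W) (1 : H)).symm k)) (extChartAt 𝓘(ℝ, W) (1 : H) 1) w := by
  have e : (fun h => X.act g h) =ᶠ[𝓝 1]
      (fun k => X.act g ((extChartAt 𝓘(ℝ, W) (1 : H)).symm k)) ∘ extChartAt 𝓘(ℝ, W) (1 : H) := by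
    filter_upwards [extChartAt_source_mem_nhds (I := 𝓘(ℝ, W)) (1 : H)] with h hh
    exact congrArg (X.act g) ((extChartAt 𝓘(ℝ, W) (1 : H)).left_inv hh).symm
  have h := logDeriv_comp (I := 𝓘(ℝ, W)) (I' := 𝓘(ℝ, W)) (ξ := ξ)
    (f := fun k => X.act g ((extChartAt 𝓘(ℝ, W) (1 : H)).symm k))
    (φ := extChartAt 𝓘(ℝ, W) (1 : H)) (x := (1 : H))
    ((X.mdifferentiable_act_right g _).comp _
      ((contMDiffAt_symm (mem_extChartAt_target _)).mdifferentiableAt (by simp)))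
    (mdifferentiableAt_extChartAt (mem_chart_source W _))
  -- The chart at `1` has derivative the identity at `1`, so the same `w` appears on both sides.
  rw [mfderiv_extChartAt_self] at h
  rw [logDeriv_congr e, h]
  rfl

/-- With `w` fixed, the first alternative kills the homomorphism `g ↦ λ_g(w)`, which is locally
constant and so trivial on the identity component. The second writes `w` as a tangent vector to the
image of `bd`, where orbits are conjugation orbits. -/
theorem IsInv.logDeriv_orbit_one_eq_zero (hξ : X.IsInv ξ)
    (hX : (∀ χ : G →* Multiplicative ℝ, (∀ g ∈ connectedComponent (1 : G), χ g = 1) → χ = 1) ∨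
      Function.Surjective (mfderiv 𝓘(ℝ, V) 𝓘(ℝ, W) X.bd 1)) (g : G) :
    logDeriv 𝓘(ℝ, W) ξ (fun h => X.act g h) 1 = 0 := by
  refine ContinuousLinearMap.ext fun w => ?_
  rcases hX with hX | hX
  · have hone : logDeriv 𝓘(ℝ, W) ξ (fun h => X.act 1 h) 1 = 0 := by
      simp only [X.one_act]
      exact logDeriv_const ξ 1 1
    let χ : G →* Multiplicative ℝ :=
      { toFun := fun g => Multiplicative.ofAdd (logDeriv 𝓘(ℝ, W) ξ (fun h => X.act g h) 1 w)
        map_one' := by rw [hone]; rfl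
        map_mul' := fun g g' => by rw [hξ.logDeriv_orbit_mul]; rfl }
    have hlc : IsLocallyConstant fun g : G => logDeriv 𝓘(ℝ, W) ξ (fun h => X.act g h) 1 w := by
      simp only [logDeriv_orbit_eq_comp_chart]
      exact hξ.isLocallyConstant_logDeriv_orbit_chart w
    have h1 := hX χ fun g hg => by
      have h := hlc.apply_eq_of_isPreconnected isPreconnected_connectedComponent hg
        (mem_connectedComponent (x := (1 : G)))
      change Multiplicative.ofAdd _ = _
      rw [h, hone]
      rfl
    exact congrArg (fun χ : G →* Multiplicative ℝ => (χ g).toAdd) h1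
  · obtain ⟨v, rfl⟩ := hX w
    exact hξ.logDeriv_orbit_mfderiv_bd g v

end LocallyConstant

end LieCrossedModule

namespace LieCrossedModule

/-! ### Forms on triangles of the nerve and the cocycle equation -/

section Cocycle

variable {V : Type*} [NormedAddCommGroup V] [NormedSpace ℝ V]
  {W : Type*} [NormedAddCommGroup W] [NormedSpace ℝ W]
  {G : Type*} [TopologicalSpace G] [ChartedSpace V G] [Group G] [LieGroup 𝓘(ℝ, V) ∞ G]
  {H : Type*} [TopologicalSpace H] [ChartedSpace W H] [Group H] [LieGroup 𝓘(ℝ, W) ∞ H]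
  (X : LieCrossedModule V W G H)

theorem isInv_of_mem_invDual (ξ : X.invDual) : X.IsInv (V := V) ξ.1 := ξ.2.2

/-- The triangle `a, b, c` of a simplex of the nerve, as a smooth map. -/
def triMap {q : ℕ} (a b c : Fin (q + 1)) : C^∞⟮modelN V W q, N G H q; 𝓘(ℝ, V), G⟯ :=
  ⟨fun x => X.triOf x a b c, X.contMDiff_triOf a b c⟩

theorem triOf_faceFun {q : ℕ} (i : Fin (q + 2)) (x : N G H (q + 1)) {a b c : Fin (q + 1)}
    (hab : a < b) (hbc : b < c) : X.triOf (X.faceFun i x) a b c =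
      X.triOf x (i.succAbove a) (i.succAbove b) (i.succAbove c) :=
  congrArg (fun σ : X.Simplex q => σ.tri a b c hab hbc)
    ((X.simplexEquiv q).apply_symm_apply (Simplex.face X i (X.simplexEquiv (q + 1) x)))

/-- The left invariant form of a linear form, as a smooth form. -/
def smoothLeftInvariantForm : (GroupLieAlgebra 𝓘(ℝ, V) G →L[ℝ] ℝ) →ₗ[ℝ] DForm 𝓘(ℝ, V) G 1 where
  toFun ξ := ⟨leftInvariantForm V G ξ, isSmoothForm_leftInvariantForm (V := V) ξ⟩
  map_add' _ _ := rfl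
  map_smul' _ _ := rfl

/-- The pullback of the left invariant form along a triangle of the nerve. -/
def triForm {q : ℕ} (a b c : Fin (q + 1)) : X.invDual →ₗ[ℝ] Form V W G H 1 q :=
  (pullback (p := 1) (X.triMap a b c)).comp (smoothLeftInvariantForm.comp X.invDual.subtype)

theorem dForm_triForm {q : ℕ} (a b c : Fin (q + 1)) (ξ : X.invDual) :
    dForm 1 q (X.triForm a b c ξ) = 0 := by
  refine (dR_pullback (X.triMap a b c) (smoothLeftInvariantForm ξ.1)).trans ?_
  have h : dR (smoothLeftInvariantForm (V := V) (G := G) ξ.1) = 0 :=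
    Subtype.ext (X.isInv_of_mem_invDual ξ).rawExtDeriv_leftInvariantForm
  rw [h, map_zero]
  rfl

/-- A face map composed with a triangle coordinate is the triangle on the corresponding vertices.
The order hypotheses are needed because a `Simplex` only records triangles with increasing vertices.
-/
theorem coface_triForm {q : ℕ} (i : Fin (q + 2)) {a b c : Fin (q + 1)} (hab : a < b) (hbc : b < c)
    (ξ : X.invDual) : X.coface 1 q i (X.triForm a b c ξ) =
      X.triForm (i.succAbove a) (i.succAbove b) (i.succAbove c) ξ := by
  refine (pullback_comp (X.triMap a b c) (X.face i) (smoothLeftInvariantForm ξ.1)).trans ?_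
  have h : (X.triMap a b c).comp (X.face i) =
      X.triMap (i.succAbove a) (i.succAbove b) (i.succAbove c) :=
    Subtype.ext (funext fun x => X.triOf_faceFun i x hab hbc)
  rw [h]
  rfl

/-- The forms on the four triangles of a tetrahedron satisfy the additive version of the
tetrahedron identity. -/
theorem triForm_tetra {q : ℕ} (a b c d : Fin (q + 1)) (ξ : X.invDual)
    (h0 : ∀ g : G, logDeriv (V := V) 𝓘(ℝ, W) ξ.1 (fun h => X.act g h) 1 = 0) :
    X.triForm a b c ξ + X.triForm a c d ξ = X.triForm b c d ξ + X.triForm a b d ξ := by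
  have hξ := X.isInv_of_mem_invDual ξ
  have hd : ∀ a b c, MDifferentiable (modelN V W q) 𝓘(ℝ, V) fun x : N G H q => X.triOf x a b c :=
    fun a b c => (X.contMDiff_triOf a b c).mdifferentiable (by simp)
  have he : MDifferentiable (modelN V W q) 𝓘(ℝ, W) fun x : N G H q => X.edgeOf x c d :=
    (X.contMDiff_edgeOf c d).mdifferentiable (by simp)
  refine Subtype.ext (funext fun x => ?_)
  have hf : ∀ a b c, (X.triForm a b c ξ).1 x =
      ContinuousAlternatingMap.ofSubsingletonLIE (𝕜 := ℝ) (F := ℝ) (0 : Fin 1)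
        (logDeriv (V := V) (modelN V W q) ξ.1 (fun x : N G H q => X.triOf x a b c) x) :=
    fun a b c => rawPullback_leftInvariantForm (V := V) ξ.1 (hd a b c x)
  -- Apply the logarithmic derivative to the tetrahedron identity; the twist of `g_abc` by the edge
  -- `c d` disappears by `IsInv.logDeriv_act`.
  have key := congrArg (fun f => logDeriv (V := V) (modelN V W q) ξ.1 f x)
    (funext fun x : N G H q => X.triOf_mul x a b c d)
  simp only [hξ.logDeriv_mul (X.mdifferentiableAt_act (hd a b c x) (he x)) (hd a c d x),
    hξ.logDeriv_mul (hd b c d x) (hd a b d x), hξ.logDeriv_act h0 (hd a b c x) (he x)] at key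
  change (X.triForm a b c ξ).1 x + (X.triForm a c d ξ).1 x =
    (X.triForm b c d ξ).1 x + (X.triForm a b d ξ).1 x
  rw [hf, hf, hf, hf]
  refine (map_add _ _ _).symm.trans (Eq.trans ?_ (map_add _ _ _))
  rw [key]

/-- The faces `d_0, d_1, d_2, d_3` give the triangles `123, 023, 013, 012`, and their alternating
sum is the additive tetrahedron identity for `0, 1, 2, 3`. -/
theorem del_triForm (ξ : X.invDual)
    (h0 : ∀ g : G, logDeriv (V := V) 𝓘(ℝ, W) ξ.1 (fun h => X.act g h) 1 = 0) :
    X.del 1 2 (X.triForm 0 1 2 ξ) = 0 := by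
  have h := X.triForm_tetra (0 : Fin 4) 1 2 3 ξ h0
  rw [X.del_apply, Fin.sum_univ_four]
  simp only [X.coface_triForm _ (show (0 : Fin 3) < 1 by decide) (show (1 : Fin 3) < 2 by decide)]
  have e0 : X.triForm ((0 : Fin 4).succAbove 0) ((0 : Fin 4).succAbove 1)
    ((0 : Fin 4).succAbove 2) ξ = X.triForm (1 : Fin 4) 2 3 ξ := rfl
  have e1 : X.triForm ((1 : Fin 4).succAbove 0) ((1 : Fin 4).succAbove 1)
    ((1 : Fin 4).succAbove 2) ξ = X.triForm (0 : Fin 4) 2 3 ξ := rfl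
  have e2 : X.triForm ((2 : Fin 4).succAbove 0) ((2 : Fin 4).succAbove 1)
    ((2 : Fin 4).succAbove 2) ξ = X.triForm (0 : Fin 4) 1 3 ξ := rfl
  have e3 : X.triForm ((3 : Fin 4).succAbove 0) ((3 : Fin 4).succAbove 1)
    ((3 : Fin 4).succAbove 2) ξ = X.triForm (0 : Fin 4) 1 2 ξ := rfl
  rw [e0, e1, e2, e3, eq_sub_of_add_eq h]
  simp only [Fin.val_zero, Fin.val_one, Fin.val_two, show ((3 : Fin 4) : ℕ) = 3 from rfl]
  module

/-- The pullbacks of left invariant forms to `N_2`, as elements of the total complex. -/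
def cocycle : X.invDual →ₗ[ℝ] Tot V W G H 3 :=
  (LinearMap.single ℝ (fun e : {e : ℕ × ℕ // e.1 + e.2 = 3} => Form V W G H e.1.1 e.1.2)
    ⟨(1, 2), rfl⟩).comp (X.triForm (0 : Fin 3) 1 2)

theorem cocycle_apply_self (ξ : X.invDual) :
    X.cocycle ξ ⟨(1, 2), rfl⟩ = X.triForm (0 : Fin 3) 1 2 ξ :=
  Pi.single_eq_same (M := fun e : {e : ℕ × ℕ // e.1 + e.2 = 3} => Form V W G H e.1.1 e.1.2)
    ⟨(1, 2), rfl⟩ (X.triForm (0 : Fin 3) 1 2 ξ)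

theorem cocycle_apply_of_ne (ξ : X.invDual) (e : {e : ℕ × ℕ // e.1 + e.2 = 3})
    (he : e.1 ≠ (1, 2)) : X.cocycle ξ e = 0 :=
  Pi.single_eq_of_ne (M := fun e : {e : ℕ × ℕ // e.1 + e.2 = 3} => Form V W G H e.1.1 e.1.2)
    (fun h => he (congrArg Subtype.val h)) _

/-- The element is concentrated in bidegree `(1, 2)`, so its differential can only have components
in `(2, 2)`, the de Rham part, and `(1, 3)`, the simplicial part. -/
theorem totD_cocycle (ξ : X.invDual)
    (h0 : ∀ g : G, logDeriv (V := V) 𝓘(ℝ, W) ξ.1 (fun h => X.act g h) 1 = 0) :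
    X.totD 3 (X.cocycle ξ) = 0 := by
  have h1 : ∀ p q (h : p + q = 3 + 1), dComp 3 p q h (X.cocycle ξ) = 0 := by
    rintro (_ | p) q h
    · rfl
    · change dForm p q (X.cocycle ξ ⟨(p, q), by omega⟩) = 0
      by_cases hp : p = 1
      · obtain rfl : q = 2 := by omega
        subst hp
        rw [cocycle_apply_self, dForm_triForm]
      · rw [cocycle_apply_of_ne _ _ _ (fun h => hp (congrArg Prod.fst h)), map_zero]
  have h2 : ∀ p q (h : p + q = 3 + 1), X.delComp 3 p q h (X.cocycle ξ) = 0 := by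
    rintro p (_ | q) h
    · rfl
    · change X.del p q (X.cocycle ξ ⟨(p, q), by omega⟩) = 0
      by_cases hp : p = 1
      · obtain rfl : q = 2 := by omega
        subst hp
        rw [cocycle_apply_self, del_triForm _ _ h0]
      · rw [cocycle_apply_of_ne _ _ _ (fun h => hp (congrArg Prod.fst h)), map_zero]
  funext e
  exact (congrArg₂ (· + ·) (h1 e.1.1 e.1.2 e.2) (h2 e.1.1 e.1.2 e.2)).trans (add_zero 0)

end Cocycle

end LieCrossedModule

end LieTwo

end

/-! ### The map of cochain complexes -/

theorem mainTheorem6 {V W G H : Type u}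
    [NormedAddCommGroup V] [NormedSpace ℝ V] [FiniteDimensional ℝ V]
    [NormedAddCommGroup W] [NormedSpace ℝ W] [FiniteDimensional ℝ W]
    [TopologicalSpace G] [ChartedSpace V G] [Group G] [LieGroup 𝓘(ℝ, V) ∞ G]
    [TopologicalSpace H] [ChartedSpace W H] [Group H] [LieGroup 𝓘(ℝ, W) ∞ H]
    (X : LieTwo.LieCrossedModule V W G H) :
    ∃ I : X.invDual →ₗ[ℝ] LieTwo.LieCrossedModule.Tot V W G H 3,
      -- `I ξ` lies in `Ω^1(N_2)`, where it is the pullback of `ξ^L` along `G × H × H → G`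
      (∀ ξ : X.invDual, (I ξ ⟨(1, 2), rfl⟩).raw =
        LieTwo.rawPullback (fun x => (X.nerveTwo x).1)
          (LieTwo.LieCrossedModule.leftInvariantForm V G ξ.1)) ∧
      (∀ (ξ : X.invDual) (e : {e : ℕ × ℕ // e.1 + e.2 = 3}), e.1 ≠ (1, 2) → I ξ e = 0) ∧
      -- the de Rham part of the cocycle equation
      (∀ ξ : X.invDual, LieTwo.LieCrossedModule.dForm 1 2 (I ξ ⟨(1, 2), rfl⟩) = 0) ∧
      -- the full cocycle equation
      (((∀ χ : G →* Multiplicative ℝ, (∀ g ∈ connectedComponent (1 : G), χ g = 1) → χ = 1) ∨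
          Function.Surjective (mfderiv 𝓘(ℝ, V) 𝓘(ℝ, W) X.bd 1)) →
        (∀ ξ : X.invDual, X.totD 3 (I ξ) = 0) ∧
        ∃ Φ : (HomologicalComplex.single (ModuleCat.{u} ℝ) (ComplexShape.up ℕ) 3).obj
            (ModuleCat.of ℝ X.invDual) ⟶ X.totComplex,
          ∀ ξ : X.invDual, (Φ.f 3).hom ((HomologicalComplex.singleObjXSelf (ComplexShape.up ℕ) 3
            (ModuleCat.of ℝ X.invDual)).inv.hom ξ) = I ξ) := by
  refine ⟨X.cocycle, fun ξ => ?_, X.cocycle_apply_of_ne, fun ξ => ?_, fun hX => ?_⟩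
  · rw [X.cocycle_apply_self]
    -- The first coordinate of `nerveTwo` is by definition the triangle `0, 1, 2`.
    rfl
  · rw [X.cocycle_apply_self, X.dForm_triForm]
  have hD : ∀ ξ : X.invDual, X.totD 3 (X.cocycle ξ) = 0 := fun ξ =>
    X.totD_cocycle ξ ((X.isInv_of_mem_invDual ξ).logDeriv_orbit_one_eq_zero hX)
  let φ : ModuleCat.of ℝ X.invDual ⟶ X.totComplex.X 3 := ModuleCat.ofHom X.cocycle
  -- A map out of a complex concentrated in degree `3` is a linear map into degree `3` whose
  -- composite with the outgoing differential is zero.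
  have hφ : ∀ k, (ComplexShape.up ℕ).Rel 3 k →
      CategoryTheory.CategoryStruct.comp φ (X.totComplex.d 3 k) = 0 := by
    rintro k rfl
    have hd : X.totComplex.d 3 (3 + 1) = ModuleCat.ofHom (X.totD 3) := CochainComplex.of_d
      (fun n => ModuleCat.of ℝ (LieTwo.LieCrossedModule.Tot V W G H n))
      (fun n => ModuleCat.ofHom (X.totD n)) 3
    refine ModuleCat.hom_ext (LinearMap.ext fun ξ => ?_)
    exact (congrArg (fun f => f.hom (X.cocycle ξ)) hd).trans (hD ξ)
  refine ⟨hD, HomologicalComplex.mkHomFromSingle φ hφ, fun ξ => ?_⟩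
  have hf : CategoryTheory.CategoryStruct.comp (HomologicalComplex.singleObjXSelf
      (ComplexShape.up ℕ) 3 (ModuleCat.of ℝ X.invDual)).inv
      ((HomologicalComplex.mkHomFromSingle φ hφ).f 3) = φ := by
    rw [HomologicalComplex.mkHomFromSingle_f, CategoryTheory.Iso.inv_hom_id_assoc]
  exact congrArg (fun f : ModuleCat.of ℝ X.invDual ⟶ X.totComplex.X 3 => f.hom ξ) hf
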